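/- Let $\mathcal M$ be a model category, $K$ a set of cofibrant objects of $\mathcal M$, $T$ a monad on $\mathcal M$, and $U:\mathrm{Alg}(T;\mathcal M)\to\mathcal M$ the forgetful functor from the category of $T$-algebras, with left adjoint the free algebra functor $T$; put $T(K)=\{T(X): X\in K\}$. Definitions. Let $\mathcal D$ be a category with classes of weak equivalences, fibrations and cofibrations; a trivial (co)fibration is a (co)fibration that is a weak equivalence. $\mathcal D$ is a *semi-model category* if: it is bicomplete; weak equivalences satisfy 2-out-of-3 and all three classes are closed under retracts; cofibrations have the left lifting property against trivial fibrations, and trivial cofibrations with cofibrant domain have it against fibrations; every map factors functorially as a cofibration followed by a trivial fibration, and every map with cofibrant domain factors functorially as a trivial cofibration followed by a fibration; fibrations and trivial fibrations are closed under pullback. $\mathcal D$ is a *semi-model category over* a model category $\mathcal N$, with respect to a functor $V:\mathcal D\to\mathcal N$, if the same axioms hold with "$A$ cofibrant in $\mathcal D$" replaced by "$V(A)$ cofibrant in $\mathcal N$" in the conditions on the domain $A$, $V$ preserves and reflects fibrations and trivial fibrations, and $V(\emptyset)$ is cofibrant in $\mathcal N$, where $\emptyset$ is the initial object. $T$-algebras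 are *admissible* (resp. *semi-admissible*) over a model structure on $\mathcal M$ if $\mathrm{Alg}(T;\mathcal M)$ has a model (resp. semi-model) structure in which $f$ is a weak equivalence or a fibration if and only if $Uf$ is one. A map $f:A\to B$ of $\mathcal D$ is an *$L$-colocal equivalence*, for a set $L$ of cofibrant objects of $\mathcal D$, if for all $X\in L$ the map $\mathrm{map}_{\mathcal D}(X,A)\to\mathrm{map}_{\mathcal D}(X,B)$ of right homotopy function complexes is a weak equivalence of simplicial sets. This map is computed as $\mathcal D(X,A_\bullet)\to\mathcal D(X,B_\bullet)$ for a simplicial resolution $A_\bullet\to B_\bullet$ (a Reedy fibrant approximation of constant simplicial objects) of $f$ or of a map weakly equivalent to $f$ by maps $A'\to A$, $B'\to B$. $R_L\mathcal D$ denotes the category $\mathcal D$ with the $L$-colocal equivalences as weak equivalences, the same fibrations, and as cofibrations the maps with the left lifting property against those maps that are both. The right Bousfield localization $R_L\mathcal D$ exists, as a model category, as a semi-model category, or as a semi-model category over $\mathcal N$, if these three classes satisfy the respective axioms. Theorem. Suppose that $R_K\mathcal M$ exists as a model category. (a) Suppose that $T$-algebras are admissible over $\mathcal M$. Then $T$-algebras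 are admissible over $R_K\mathcal M$ if and only if the right Bousfield localization $R_{T(K)}\mathrm{Alg}(T;\mathcal M)$ exists as a model category. If either holds, the model categories $\mathrm{Alg}(T;R_K\mathcal M)$ and $R_{T(K)}\mathrm{Alg}(T;\mathcal M)$ are equal. (b) Suppose that $T$-algebras are semi-admissible over $\mathcal M$. Then $T$-algebras are semi-admissible over $R_K\mathcal M$ if and only if $R_{T(K)}\mathrm{Alg}(T;\mathcal M)$ exists as a semi-model category. If either holds, the semi-model categories $\mathrm{Alg}(T;R_K\mathcal M)$ and $R_{T(K)}\mathrm{Alg}(T;\mathcal M)$ are equal. Both assertions also hold when "semi-model category" is replaced throughout these two sentences by "semi-model category over $R_K\mathcal M$ with respect to $U$". -/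

import Mathlib

open CategoryTheory Limits Opposite HomotopicalAlgebra

universe v u u'

namespace RightLoc

/-! ### Weak equivalences of simplicial sets -/

/-- The equivalence relation on maps of simplicial sets generated by simplicial homotopy. -/
def SHomotopic {X Z : SSet.{v}} (f g : X ⟶ Z) : Prop :=
  Relation.EqvGen (fun a b : X ⟶ Z => Nonempty (SSet.Homotopy a b)) f g

/-- A map `f : X ⟶ Y` of simplicial sets is a (Kan-Quillen) weak equivalence if, for every Kan
complex `Z`, precomposition with `f` is a bijection `[Y, Z] → [X, Z]` on simplicial homotopy
classes of maps. -/
def IsSSetWeakEquivalence {X Y : SSet.{v}} (f : X ⟶ Y) : Prop :=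
  ∀ Z : SSet.{v}, SSet.KanComplex Z →
    (∀ g : X ⟶ Z, ∃ h : Y ⟶ Z, SHomotopic (f ≫ h) g) ∧
    (∀ h h' : Y ⟶ Z, SHomotopic (f ≫ h) (f ≫ h') → SHomotopic h h')

/-! ### Three distinguished classes of maps -/

/-- Three distinguished classes of maps on a category, with no axioms. -/
@[ext]
structure ModelClasses (D : Type u) [Category.{v} D] where
  /-- weak equivalences -/
  W : MorphismProperty D
  /-- fibrations -/
  Fib : MorphismProperty D
  /-- cofibrations -/
  Cof : MorphismProperty D

namespace ModelClasses

/-- The three classes of a model category. -/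
def ofModelCategory (D : Type u) [Category.{v} D] [ModelCategory D] : ModelClasses D where
  W := weakEquivalences D
  Fib := fibrations D
  Cof := cofibrations D

variable {D : Type u} [Category.{v} D] (S : ModelClasses D)

/-- Trivial fibrations. -/
def TrivFib : MorphismProperty D := S.Fib ⊓ S.W

/-- Trivial cofibrations. -/
def TrivCof : MorphismProperty D := S.Cof ⊓ S.W

/-- The cofibrant objects: the map from the initial object is a cofibration. -/
def Cofibrant : ObjectProperty D := fun X => ∃ (I : D) (hI : IsInitial I), S.Cof (hI.to X)

/-- The three classes satisfy the axioms of a model category. -/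
def IsModel : Prop := ∃ h : ModelCategory D, @ofModelCategory D _ h = S

/-! ### Semi-model categories -/

end ModelClasses

/-- A functorial factorization, as a map in `L` followed by a map in `R`, of all the maps
satisfying `P`. -/
structure FunctorialFactorizationOn {D : Type u} [Category.{v} D] (P : ObjectProperty (Arrow D))
    (L R : MorphismProperty D) where
  /-- the middle object -/
  Z : P.FullSubcategory ⥤ D
  /-- the first map -/
  i : P.ι ⋙ Arrow.leftFunc ⟶ Z
  /-- the second map -/
  p : Z ⟶ P.ι ⋙ Arrow.rightFunc
  fac (f : P.FullSubcategory) : i.app f ≫ p.app f = f.obj.hom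
  hi (f : P.FullSubcategory) : L (i.app f)
  hp (f : P.FullSubcategory) : R (p.app f)

namespace ModelClasses

variable {D : Type u} [Category.{v} D]

/-- The axioms of a semi-model category, in which lifting and factorization for trivial
cofibrations and fibrations are required for maps with domain in `dom` only. -/
structure SemiModelAxioms (S : ModelClasses D) (dom : ObjectProperty D) : Prop where
  hasLimits : HasLimits D
  hasColimits : HasColimits D
  two_out_of_three : S.W.HasTwoOutOfThreeProperty
  retract_W : S.W.IsStableUnderRetracts
  retract_Fib : S.Fib.IsStableUnderRetracts
  retract_Cof : S.Cof.IsStableUnderRetracts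
  lift_cof_trivFib {A B X Y : D} (i : A ⟶ B) (p : X ⟶ Y) :
    S.Cof i → S.TrivFib p → HasLiftingProperty i p
  lift_trivCof_fib {A B X Y : D} (i : A ⟶ B) (p : X ⟶ Y) :
    dom A → S.TrivCof i → S.Fib p → HasLiftingProperty i p
  factor_cof_trivFib : MorphismProperty.HasFunctorialFactorization S.Cof S.TrivFib
  factor_trivCof_fib :
    Nonempty (FunctorialFactorizationOn (fun f : Arrow D => dom f.left) S.TrivCof S.Fib)
  pullback_fib : S.Fib.IsStableUnderBaseChange
  pullback_trivFib : S.TrivFib.IsStableUnderBaseChange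

/-- A semi-model category: the axioms on trivial cofibrations are required for maps with
cofibrant domain. -/
def IsSemiModel (S : ModelClasses D) : Prop := S.SemiModelAxioms S.Cofibrant

/-- A semi-model category over a base: here the axioms on trivial cofibrations concern the maps
whose domain becomes cofibrant in the base `(M, N)` after applying `U : D ⥤ M`.
Conditions on `(M, N)` and `U` alone (cofibrant generation of the base, preservation of ordinal
colimits by `U`) are not part of this predicate. -/
structure IsSemiModelOver (S : ModelClasses D) {M : Type u'} [Category.{v} M]
    (N : ModelClasses M) (U : D ⥤ M) : Prop extends
    S.SemiModelAxioms (fun A => N.Cofibrant (U.obj A)) where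
  fib_iff {A B : D} (f : A ⟶ B) : S.Fib f ↔ N.Fib (U.map f)
  trivFib_iff {A B : D} (f : A ⟶ B) : S.TrivFib f ↔ N.TrivFib (U.map f)
  initial_cofibrant {I : D} (hI : IsInitial I) : N.Cofibrant (U.obj I)

end ModelClasses

/-! ### Simplicial resolutions and homotopy function complexes -/

section Reedy

variable {D : Type u} [Category.{v} D]

/-- The proper faces of the standard `n`-simplex: the non-invertible injections into `[n]`. -/
def properFaces (n : ℕ) : ObjectProperty (Over (SimplexCategory.mk n)) :=
  fun f => Mono f.hom ∧ ¬ IsIso f.hom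

/-- The diagram of the `X_k` over the proper faces `[k] ↪ [n]`; its limit is the `n`-th matching
object of `X`. -/
def matchingDiagram (X : SimplicialObject D) (n : ℕ) :
    (properFaces n).FullSubcategoryᵒᵖ ⥤ D :=
  ((properFaces n).ι ⋙ Over.forget _).op ⋙ X

/-- The cone with apex `X_n` given by the face maps. -/
def matchingCone (X : SimplicialObject D) (n : ℕ) : Cone (matchingDiagram X n) where
  pt := X.obj (op (SimplexCategory.mk n))
  π :=
    { app := fun f => X.map f.unop.obj.hom.op
      naturality := fun f g a => by
        have h : a.unop.hom.left ≫ f.unop.obj.hom = g.unop.obj.hom := Over.w a.unop.hom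
        change 𝟙 _ ≫ X.map g.unop.obj.hom.op = X.map f.unop.obj.hom.op ≫ X.map a.unop.hom.left.op
        rw [Category.id_comp, ← X.map_comp, ← op_comp, h] }

namespace ModelClasses

variable (S : ModelClasses D)

/-- `X` is Reedy fibrant: each map from `X_n` to the `n`-th matching object is a fibration. -/
def ReedyFibrant (X : SimplicialObject D) : Prop :=
  ∀ n : ℕ, ∃ (c : Cone (matchingDiagram X n)) (hc : IsLimit c),
    S.Fib (hc.lift (matchingCone X n))

/-- `j` exhibits `X` as a simplicial resolution of `A`: a Reedy fibrant approximation of the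
constant simplicial object on `A`. -/
structure IsSimplicialResolution {A : D} {X : SimplicialObject D}
    (j : (SimplicialObject.const D).obj A ⟶ X) : Prop where
  reedyFibrant : S.ReedyFibrant X
  weq (n : SimplexCategoryᵒᵖ) : S.W (j.app n)

/-- A simplicial resolution of a map `f : A ⟶ B`. In a model category one can take
`A' = A` and `B' = B`, with identities as `a` and `b`; in a semi-model category an object need
not have a fibrant approximation before it is replaced by a weakly equivalent one, for instance
by a cofibrant approximation. -/
structure MapResolution {A B : D} (f : A ⟶ B) where
  /-- an object weakly equivalent to `A` -/
  A' : D
  /-- an object weakly equivalent to `B` -/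
  B' : D
  /-- the approximation of `A` -/
  a : A' ⟶ A
  /-- the approximation of `B` -/
  b : B' ⟶ B
  weq_a : S.W a
  weq_b : S.W b
  /-- the approximation of `f` -/
  f' : A' ⟶ B'
  comm : a ≫ f = f' ≫ b
  /-- the resolution of the source -/
  resA : SimplicialObject D
  /-- the resolution of the target -/
  resB : SimplicialObject D
  /-- the coaugmentation of the source -/
  jA : (SimplicialObject.const D).obj A' ⟶ resA
  /-- the coaugmentation of the target -/
  jB : (SimplicialObject.const D).obj B' ⟶ resB
  isRes_A : S.IsSimplicialResolution jA
  isRes_B : S.IsSimplicialResolution jB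
  /-- the resolution of `f` -/
  φ : resA ⟶ resB
  comm_res : jA ≫ φ = (SimplicialObject.const D).map f' ≫ jB

end ModelClasses

/-- The map of simplicial sets `D(X, A_•) ⟶ D(X, B_•)` induced by `φ : A_• ⟶ B_•`. -/
def homMap (X : D) {A B : SimplicialObject D} (φ : A ⟶ B) :
    (((SimplicialObject.whiskering D (Type v)).obj (coyoneda.obj (op X))).obj A : SSet.{v}) ⟶
      ((SimplicialObject.whiskering D (Type v)).obj (coyoneda.obj (op X))).obj B :=
  ((SimplicialObject.whiskering D (Type v)).obj (coyoneda.obj (op X))).map φ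

/-! ### Right Bousfield localization -/

namespace ModelClasses

variable (S : ModelClasses D)

/-- `K`-colocal equivalences, for a set `K` of cofibrant objects: for all `X ∈ K`, the map
induced by `f` on right homotopy function complexes out of `X` is a weak equivalence. As `X` is
cofibrant, no cofibrant approximation of `X` is needed. -/
def ColocalEquivalence (K : Set D) : MorphismProperty D := fun _ _ f =>
  ∀ X ∈ K, ∃ r : S.MapResolution f, IsSSetWeakEquivalence (homMap X r.φ)

/-- The three classes of the right Bousfield localization: the weak equivalences are the
`K`-colocal equivalences, the fibrations are unchanged, and the cofibrations are the maps with the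
left lifting property against the maps that are both. The localization exists, as a model or
semi-model category, if these classes satisfy the respective axioms. -/
def rightBousfield (K : Set D) : ModelClasses D where
  W := S.ColocalEquivalence K
  Fib := S.Fib
  Cof := (S.Fib ⊓ S.ColocalEquivalence K).llp

end ModelClasses

end Reedy

/-! ### Algebras over a monad -/

section Algebras

variable {M : Type u} [Category.{v} M] {T : Monad M}

/-- Weak equivalences and fibrations of `T`-algebras are created by the forgetful functor from
the classes `N` on `M`. -/
structure IsTransferred (N : ModelClasses M) (S : ModelClasses T.Algebra) : Prop where
  weq_iff {A B : T.Algebra} (f : A ⟶ B) : S.W f ↔ N.W (T.forget.map f)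
  fib_iff {A B : T.Algebra} (f : A ⟶ B) : S.Fib f ↔ N.Fib (T.forget.map f)

/-- `S` is a transferred model structure: it witnesses that `T`-algebras are admissible
over `(M, N)`. -/
def IsAdmissibleStructure (N : ModelClasses M) (S : ModelClasses T.Algebra) : Prop :=
  IsTransferred N S ∧ S.IsModel

/-- `S` is a transferred semi-model structure: it witnesses that `T`-algebras are semi-admissible
over `(M, N)`. -/
def IsSemiAdmissibleStructure (N : ModelClasses M) (S : ModelClasses T.Algebra) : Prop :=
  IsTransferred N S ∧ S.IsSemiModel

/-- The variant of semi-admissibility in which cofibrancy of domains is tested in the base. -/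
def IsSemiAdmissibleOverStructure (N : ModelClasses M) (S : ModelClasses T.Algebra) : Prop :=
  IsTransferred N S ∧ S.IsSemiModelOver N T.forget

end Algebras

end RightLoc

/-!
Homotopy function complexes out of a cofibrant object do not depend on the chosen resolution: two
resolutions of `f` both map, by levelwise weak equivalences, to a Reedy fibrant replacement of `f`,
and `M(X, -)` sends Reedy trivial fibrations to weak equivalences, so that Ken Brown's argument
applies. The forgetful functor `U` preserves limits, weak equivalences and fibrations, hence
resolutions, and the adjunction identifies `map(T X, A)` with `map(X, U A)`. Therefore the
`T(K)`-colocal equivalences of algebras are exactly the maps which `U` sends to `K`-colocal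
equivalences. Both structures to be compared thus have the same weak equivalences and the same
fibrations, and the cofibrations are determined by a lifting property.
-/

namespace RightLoc

section SimplicialSets

open MonoidalCategory CartesianMonoidalCategory

variable {X Y Z : SSet.{v}}

lemma sHomotopic_of_cylinder {f g : X ⟶ Y} (h : X ⊗ SSet.stdSimplex.obj (.mk 1) ⟶ Y)
    (h₀ : SSet.ι₀ ≫ h = f) (h₁ : SSet.ι₁ ≫ h = g) : SHomotopic f g :=
  .rel _ _ ⟨{ h := h, h₀ := h₀, h₁ := h₁, rel := by ext n ⟨⟨_, hx⟩, _⟩; exact hx.elim }⟩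

namespace SHomotopic

lemma map {X' Y' : SSet.{v}} (Φ : (X ⟶ Y) → (X' ⟶ Y'))
    (hΦ : ∀ a b : X ⟶ Y, SSet.Homotopy a b → SHomotopic (Φ a) (Φ b))
    {f g : X ⟶ Y} (h : SHomotopic f g) : SHomotopic (Φ f) (Φ g) := by
  induction h with
  | rel a b h => exact hΦ _ _ h.some
  | refl a => exact .refl _
  | symm a b _ ih => exact .symm _ _ ih
  | trans a b c _ _ ih₁ ih₂ => exact .trans _ _ _ ih₁ ih₂

lemma comp_right {f g : X ⟶ Y} (h : SHomotopic f g) (k : Y ⟶ Z) :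
    SHomotopic (f ≫ k) (g ≫ k) :=
  h.map (· ≫ k) fun _ _ H => sHomotopic_of_cylinder (H.h ≫ k)
    (SSet.Homotopy.h₀_assoc H k) (SSet.Homotopy.h₁_assoc H k)

lemma comp_left {f g : Y ⟶ Z} (h : SHomotopic f g) (k : X ⟶ Y) :
    SHomotopic (k ≫ f) (k ≫ g) :=
  h.map (k ≫ ·) fun _ _ H => sHomotopic_of_cylinder (k ▷ _ ≫ H.h)
    (by rw [← Category.assoc, SSet.ι₀_comp, Category.assoc, H.h₀])
    (by rw [← Category.assoc, SSet.ι₁_comp, Category.assoc, H.h₁])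

end SHomotopic

/-- The set `[X, Z]` of simplicial homotopy classes of maps of simplicial sets. -/
def HomotopyClass (X Z : SSet.{v}) : Type v :=
  Quot fun f g : X ⟶ Z => SHomotopic f g

namespace HomotopyClass

lemma mk_eq_mk_iff {f g : X ⟶ Z} :
    (Quot.mk _ f : HomotopyClass X Z) = Quot.mk _ g ↔ SHomotopic f g :=
  Equivalence.quot_mk_eq_iff (r := SHomotopic) (Relation.EqvGen.is_equivalence _) f g

/-- Precomposition with `f`, as a map `[Y, Z] → [X, Z]`. -/
def precomp (f : X ⟶ Y) (Z : SSet.{v}) : HomotopyClass Y Z → HomotopyClass X Z :=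
  Quot.map (f ≫ ·) fun _ _ h => h.comp_left f

lemma precomp_comp {Z' : SSet.{v}} (f : X ⟶ Y) (g : Y ⟶ Z) :
    precomp (f ≫ g) Z' = precomp f Z' ∘ precomp g Z' := by
  ext ⟨h⟩
  exact congrArg (Quot.mk _) (Category.assoc f g h)

lemma precomp_eq_id {f : X ⟶ X} (hf : SHomotopic f (𝟙 X)) : precomp f Z = id := by
  ext ⟨h⟩
  exact mk_eq_mk_iff.2 (by simpa using hf.comp_right h)

end HomotopyClass

lemma isSSetWeakEquivalence_iff_bijective (f : X ⟶ Y) :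
    IsSSetWeakEquivalence f ↔
      ∀ Z : SSet.{v}, SSet.KanComplex Z → Function.Bijective (HomotopyClass.precomp f Z) := by
  refine forall₂_congr fun Z _ => ?_
  rw [and_comm, Function.Bijective]
  refine and_congr ⟨?_, fun H g g' h => ?_⟩ ⟨?_, fun H g => ?_⟩
  · rintro H ⟨g⟩ ⟨g'⟩ h
    exact HomotopyClass.mk_eq_mk_iff.2 (H g g' (HomotopyClass.mk_eq_mk_iff.1 h))
  · exact HomotopyClass.mk_eq_mk_iff.1 (H (HomotopyClass.mk_eq_mk_iff.2 h))
  · rintro H ⟨g⟩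
    obtain ⟨h, hh⟩ := H g
    exact ⟨Quot.mk _ h, HomotopyClass.mk_eq_mk_iff.2 hh⟩
  · obtain ⟨⟨h⟩, hh⟩ := H (Quot.mk _ g)
    exact ⟨h, HomotopyClass.mk_eq_mk_iff.1 hh⟩

/-- The class of weak equivalences of simplicial sets. -/
def sSetWeakEquivalences : MorphismProperty SSet.{v} := fun _ _ f => IsSSetWeakEquivalence f

instance : (sSetWeakEquivalences.{v}).HasTwoOutOfThreeProperty where
  comp_mem f g hf hg := by
    simp only [sSetWeakEquivalences, isSSetWeakEquivalence_iff_bijective,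
      HomotopyClass.precomp_comp] at hf hg ⊢
    exact fun Z hZ => (hf Z hZ).comp (hg Z hZ)
  of_postcomp f g hg hfg := by
    simp only [sSetWeakEquivalences, isSSetWeakEquivalence_iff_bijective,
      HomotopyClass.precomp_comp] at hg hfg ⊢
    exact fun Z hZ => (Function.Bijective.of_comp_iff _ (hg Z hZ)).1 (hfg Z hZ)
  of_precomp f g hf hfg := by
    simp only [sSetWeakEquivalences, isSSetWeakEquivalence_iff_bijective,
      HomotopyClass.precomp_comp] at hf hfg ⊢
    exact fun Z hZ => (Function.Bijective.of_comp_iff' (hf Z hZ) _).1 (hfg Z hZ)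

lemma isSSetWeakEquivalence_of_homotopyInverse (f : X ⟶ Y) (g : Y ⟶ X)
    (hfg : SHomotopic (f ≫ g) (𝟙 X)) (hgf : SHomotopic (g ≫ f) (𝟙 Y)) :
    IsSSetWeakEquivalence f := by
  rw [isSSetWeakEquivalence_iff_bijective]
  intro Z _
  refine Function.bijective_iff_has_inverse.2 ⟨HomotopyClass.precomp g Z, ?_, ?_⟩
  · rw [Function.leftInverse_iff_comp, ← HomotopyClass.precomp_comp,
      HomotopyClass.precomp_eq_id hgf]
  · rw [Function.rightInverse_iff_comp, ← HomotopyClass.precomp_comp,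
      HomotopyClass.precomp_eq_id hfg]

instance : (sSetWeakEquivalences.{v}).RespectsIso :=
  MorphismProperty.respectsIso_of_isStableUnderComposition fun _ _ f (_ : IsIso f) =>
    isSSetWeakEquivalence_of_homotopyInverse f (inv f)
      (by rw [IsIso.hom_inv_id]; exact .refl _) (by rw [IsIso.inv_hom_id]; exact .refl _)

/-- The two ends of the cylinder are disjoint, so there is no compatibility condition to glue maps
on them. -/
lemma pullback_fst_ι₀_ι₁_comp_eq (f g : X ⟶ Y) :
    pullback.fst (SSet.ι₀ (X := X)) SSet.ι₁ ≫ f = pullback.snd SSet.ι₀ SSet.ι₁ ≫ g := by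
  ext n x
  have hx : SSet.ι₀.app n ((pullback.fst SSet.ι₀ SSet.ι₁).app n x) =
      SSet.ι₁.app n ((pullback.snd SSet.ι₀ SSet.ι₁).app n x) :=
    ConcreteCategory.congr_hom (C := Type v)
      (NatTrans.congr_app (pullback.condition (f := SSet.ι₀ (X := X)) (g := SSet.ι₁)) n) x
  have h₀₁ := congrArg (fun z => (SSet.stdSimplex.objEquiv z.2).toOrderHom 0) hx
  exact (zero_ne_one h₀₁).elim

lemma isSSetWeakEquivalence_of_rlp_monomorphisms {p : X ⟶ Y}
    (hp : (MorphismProperty.monomorphisms SSet.{v}).rlp p) : IsSSetWeakEquivalence p := by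
  have : Mono (SSet.ι₀ (X := X)) := mono_of_mono_fac (SSet.ι₀_fst X)
  have : Mono (SSet.ι₁ (X := X)) := mono_of_mono_fac (SSet.ι₁_fst X)
  have : Adhesive SSet.{v} := adhesive_functor
  let ends := pushout.desc (SSet.ι₀ (X := X)) SSet.ι₁ pullback.condition
  have h₀ : pushout.inl _ _ ≫ ends = SSet.ι₀ := pushout.inl_desc _ _ _
  have h₁ : pushout.inr _ _ ≫ ends = SSet.ι₁ := pushout.inr_desc _ _ _
  have : HasLiftingProperty (⊥ : Y.Subcomplex).ι p := hp _ (.infer_property _)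
  have : HasLiftingProperty ends p := hp _ (.infer_property _)
  have sq : CommSq (SSet.Subcomplex.isInitialBot.to X) (⊥ : Y.Subcomplex).ι p (𝟙 Y) :=
    ⟨SSet.Subcomplex.isInitialBot.hom_ext _ _⟩
  have sq' : CommSq (pushout.desc (p ≫ sq.lift) (𝟙 X) (pullback_fst_ι₀_ι₁_comp_eq _ _)) ends p
      (fst _ _ ≫ p) :=
    ⟨pushout.hom_ext
      (by rw [pushout.inl_desc_assoc, reassoc_of% h₀, Category.assoc, sq.fac_right,
        SSet.ι₀_fst_assoc, Category.comp_id])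
      (by rw [pushout.inr_desc_assoc, reassoc_of% h₁, SSet.ι₁_fst_assoc, Category.id_comp])⟩
  refine isSSetWeakEquivalence_of_homotopyInverse p sq.lift
    (sHomotopic_of_cylinder sq'.lift ?_ ?_) (by rw [sq.fac_right]; exact .refl _)
  · calc
      _ = (pushout.inl _ _ ≫ ends) ≫ sq'.lift := by rw [h₀]
      _ = p ≫ sq.lift := by rw [Category.assoc, sq'.fac_left, pushout.inl_desc]
  · calc
      _ = (pushout.inr _ _ ≫ ends) ≫ sq'.lift := by rw [h₁]
      _ = 𝟙 X := by rw [Category.assoc, sq'.fac_left, pushout.inr_desc]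

end SimplicialSets

section Matching

open Simplicial

instance (n : ℕ) : Finite (properFaces n).FullSubcategory := by
  let Faces := Σ k : Fin (n + 1), {μ : ⦋k⦌ ⟶ ⦋n⦌ // properFaces n (Over.mk μ)}
  let toFace : Faces → (properFaces n).FullSubcategory := fun s => ⟨Over.mk s.2.1, s.2.2⟩
  refine Finite.of_surjective toFace fun x => ?_
  have : Mono x.obj.hom := x.property.1
  have len_le : x.obj.left.len ≤ n := SimplexCategory.len_le_of_mono x.obj.hom
  exact ⟨⟨⟨x.obj.left.len, by lia⟩, ⟨x.obj.hom, x.property⟩⟩, rfl⟩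

instance (n : ℕ) (x y : (properFaces n).FullSubcategory) : Finite (x ⟶ y) :=
  Finite.of_injective (fun a => a.hom.left) fun a b h => by
    ext : 2
    exact h

noncomputable instance (n : ℕ) : FinCategory (properFaces n).FullSubcategory where
  fintypeObj := Fintype.ofFinite _
  fintypeHom _ _ := Fintype.ofFinite _

variable {n : ℕ} {k l : SimplexCategory}

lemma not_epi_of_properFaces {μ : k ⟶ ⦋n⦌} (hμ : properFaces n (Over.mk μ)) : ¬ Epi μ := fun _ =>
  have : Mono μ := hμ.1
  hμ.2 (isIso_of_mono_of_epi μ)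

lemma len_lt_of_properFaces {μ : k ⟶ ⦋n⦌} (hμ : properFaces n (Over.mk μ)) : k.len < n := by
  have : Mono μ := hμ.1
  exact lt_of_le_of_ne (SimplexCategory.len_le_of_mono μ) fun h =>
    hμ.2 ((SimplexCategory.isIso_iff_of_mono μ).2 h)

lemma properFaces_image_ι {θ : k ⟶ ⦋n⦌} (hθ : ¬ Epi θ) : properFaces n (Over.mk (image.ι θ)) :=
  ⟨inferInstanceAs (Mono (image.ι θ)), fun (_ : IsIso (image.ι θ)) => hθ (by
    rw [← image.fac θ]
    infer_instance)⟩

lemma not_epi_comp {θ : k ⟶ ⦋n⦌} (hθ : ¬ Epi θ) (α : l ⟶ k) : ¬ Epi (α ≫ θ) :=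
  fun _ => hθ (epi_of_epi α θ)

variable {D : Type u} [Category.{v} D]

section MatchingObject

variable [HasFiniteLimits D]

/-- The `n`-th matching object, as a functor of the simplicial object. -/
noncomputable def matchingFunctor (D : Type u) [Category.{v} D] [HasFiniteLimits D] (n : ℕ) :
    SimplicialObject D ⥤ D :=
  (Functor.whiskeringLeft _ _ D).obj ((properFaces n).ι ⋙ Over.forget _).op ⋙ lim

instance {J : Type*} [Category* J] [HasLimitsOfShape J D] :
    PreservesLimitsOfShape J (matchingFunctor D n) :=
  inferInstanceAs (PreservesLimitsOfShape _ (_ ⋙ lim))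

variable (X : SimplicialObject D) {Y : SimplicialObject D} (φ : X ⟶ Y) {V : D}

/-- The `n`-th matching object, written `M_n X` in the literature. -/
noncomputable abbrev matchingObj (n : ℕ) : D := (matchingFunctor D n).obj X

/-- The projection of the matching object to a proper face. -/
noncomputable def matchingπ (μ : k ⟶ ⦋n⦌) (hμ : properFaces n (Over.mk μ)) :
    matchingObj X n ⟶ X.obj (op k) :=
  limit.π (matchingDiagram X n) (op ⟨Over.mk μ, hμ⟩)

/-- The map from `X_n` to the matching object given by the faces. -/
noncomputable def matchingMap (n : ℕ) : X.obj (op ⦋n⦌) ⟶ matchingObj X n :=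
  limit.lift (matchingDiagram X n) (matchingCone X n)

lemma matchingπ_map (μ : k ⟶ ⦋n⦌) (hμ : properFaces n (Over.mk μ)) (α : l ⟶ k)
    (hαμ : properFaces n (Over.mk (α ≫ μ))) :
    matchingπ X μ hμ ≫ X.map α.op = matchingπ X (α ≫ μ) hαμ := by
  let a : (⟨Over.mk (α ≫ μ), hαμ⟩ : (properFaces n).FullSubcategory) ⟶ ⟨Over.mk μ, hμ⟩ :=
    ObjectProperty.homMk (Over.homMk α)
  exact limit.w (matchingDiagram X n) a.op

variable {X}

lemma matchingObj_hom_ext {f g : V ⟶ matchingObj X n}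
    (h : ∀ (k : SimplexCategory) (μ : k ⟶ ⦋n⦌) (hμ : properFaces n (Over.mk μ)),
      f ≫ matchingπ X μ hμ = g ≫ matchingπ X μ hμ) : f = g :=
  limit.hom_ext fun j => h _ j.unop.obj.hom j.unop.property

/-- The map to the matching object given by a compatible family of maps, one for each proper
face. -/
noncomputable def matchingLift
    (f : ∀ (k : SimplexCategory) (μ : k ⟶ ⦋n⦌), properFaces n (Over.mk μ) → (V ⟶ X.obj (op k)))
    (hf : ∀ (k l : SimplexCategory) (μ : k ⟶ ⦋n⦌) (α : l ⟶ k) (hμ : properFaces n (Over.mk μ))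
      (hαμ : properFaces n (Over.mk (α ≫ μ))), f k μ hμ ≫ X.map α.op = f l (α ≫ μ) hαμ) :
    V ⟶ matchingObj X n :=
  limit.lift (matchingDiagram X n)
    { pt := V
      π :=
        { app j := f _ j.unop.obj.hom j.unop.property
          naturality j j' a := by
            have w : a.unop.hom.left ≫ j.unop.obj.hom = j'.unop.obj.hom := Over.w a.unop.hom
            have congr {ν ν' : j'.unop.obj.left ⟶ ⦋n⦌} (e : ν = ν') (hν) (hν') :
                f _ ν hν = f _ ν' hν' := by subst e; rfl
            exact (Category.id_comp _).trans ((congr w.symm _ (by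
              rw [w]; exact j'.unop.property)).trans
                (hf _ _ j.unop.obj.hom a.unop.hom.left j.unop.property _).symm) } }

lemma matchingLift_π
    (f : ∀ (k : SimplexCategory) (μ : k ⟶ ⦋n⦌), properFaces n (Over.mk μ) → (V ⟶ X.obj (op k)))
    (hf) (μ : k ⟶ ⦋n⦌) (hμ : properFaces n (Over.mk μ)) :
    matchingLift f hf ≫ matchingπ X μ hμ = f k μ hμ :=
  limit.lift_π _ _

variable (X)

/-- The map from the matching object to `X_k` given by a simplex of the boundary of the standard
`n`-simplex, possibly degenerate. -/
noncomputable def matchingEval (θ : k ⟶ ⦋n⦌) (hθ : ¬ Epi θ) : matchingObj X n ⟶ X.obj (op k) :=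
  matchingπ X (image.ι θ) (properFaces_image_ι hθ) ≫ X.map (factorThruImage θ).op

lemma matchingEval_comp (e : k ⟶ l) (μ : l ⟶ ⦋n⦌) (hμ : properFaces n (Over.mk μ)) :
    matchingEval X (e ≫ μ) (not_epi_comp (not_epi_of_properFaces hμ) e) =
      matchingπ X μ hμ ≫ X.map e.op := by
  have : Mono μ := hμ.1
  let F : MonoFactorisation (e ≫ μ) := { I := l, m := μ, e := e }
  have lift_comp : image.lift F ≫ μ = image.ι (e ≫ μ) := image.lift_fac F
  have comp_lift : factorThruImage (e ≫ μ) ≫ image.lift F = e := by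
    rw [← cancel_mono μ, Category.assoc, lift_comp, image.fac]
  have hι := properFaces_image_ι (not_epi_comp (not_epi_of_properFaces hμ) e)
  have π_ι : matchingπ X (image.ι (e ≫ μ)) hι = matchingπ X μ hμ ≫ X.map (image.lift F).op := by
    rw [matchingπ_map X μ hμ (image.lift F) (by rwa [lift_comp])]
    congr 1
    exact lift_comp.symm
  rw [matchingEval, π_ι, Category.assoc, ← X.map_comp, ← op_comp, comp_lift]

lemma matchingEval_of_properFaces (μ : k ⟶ ⦋n⦌) (hμ : properFaces n (Over.mk μ)) :
    matchingEval X μ (not_epi_of_properFaces hμ) = matchingπ X μ hμ := by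
  simpa using matchingEval_comp X (𝟙 k) μ hμ

lemma matchingEval_map (θ : k ⟶ ⦋n⦌) (hθ : ¬ Epi θ) (α : l ⟶ k) :
    matchingEval X θ hθ ≫ X.map α.op = matchingEval X (α ≫ θ) (not_epi_comp hθ α) := by
  have := matchingEval_comp X (α ≫ factorThruImage θ) (image.ι θ) (properFaces_image_ι hθ)
  simp only [Category.assoc, image.fac] at this
  rw [this, matchingEval, Category.assoc, op_comp, X.map_comp]

lemma matchingMap_π (μ : k ⟶ ⦋n⦌) (hμ : properFaces n (Over.mk μ)) :
    matchingMap X n ≫ matchingπ X μ hμ = X.map μ.op :=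
  limit.lift_π _ _

lemma matchingMap_eval (θ : k ⟶ ⦋n⦌) (hθ : ¬ Epi θ) :
    matchingMap X n ≫ matchingEval X θ hθ = X.map θ.op := by
  rw [matchingEval, reassoc_of% @matchingMap_π, ← X.map_comp, ← op_comp, image.fac]

variable {X}

/-- The map of matching objects induced by a map of simplicial objects. -/
noncomputable abbrev matchingObjMap (n : ℕ) : matchingObj X n ⟶ matchingObj Y n :=
  (matchingFunctor D n).map φ

lemma matchingObjMap_π (μ : k ⟶ ⦋n⦌) (hμ : properFaces n (Over.mk μ)) :
    matchingObjMap φ n ≫ matchingπ Y μ hμ = matchingπ X μ hμ ≫ φ.app (op k) :=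
  limMap_π _ _

lemma matchingObjMap_eval (θ : k ⟶ ⦋n⦌) (hθ : ¬ Epi θ) :
    matchingObjMap φ n ≫ matchingEval Y θ hθ = matchingEval X θ hθ ≫ φ.app (op k) := by
  rw [matchingEval, matchingEval, reassoc_of% @matchingObjMap_π, Category.assoc, φ.naturality]

lemma matchingMap_naturality (n : ℕ) :
    matchingMap X n ≫ matchingObjMap φ n = φ.app (op ⦋n⦌) ≫ matchingMap Y n :=
  matchingObj_hom_ext fun k μ hμ => by
    rw [Category.assoc, Category.assoc, matchingObjMap_π, matchingMap_π, reassoc_of% @matchingMap_π,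
      φ.naturality]

lemma isIso_matchingObjMap (h : ∀ k : SimplexCategory, k.len < n → IsIso (φ.app (op k))) :
    IsIso (matchingObjMap φ n) := by
  have (x : (properFaces n).FullSubcategoryᵒᵖ) :
      IsIso ((Functor.whiskerLeft ((properFaces n).ι ⋙ Over.forget _).op φ).app x) :=
    h _ (len_lt_of_properFaces x.unop.property)
  have := NatIso.isIso_of_isIso_app (Functor.whiskerLeft ((properFaces n).ι ⋙ Over.forget _).op φ)
  exact inferInstanceAs (IsIso (lim.map
    (Functor.whiskerLeft ((properFaces n).ι ⋙ Over.forget _).op φ)))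

end MatchingObject

section RelativeMatching

variable [HasFiniteLimits D] {X Y Z : SimplicialObject D} (φ : X ⟶ Y) (ψ : Y ⟶ Z)

/-- The relative matching object `M_n X ×_{M_n Y} Y_n` of a map of simplicial objects. -/
noncomputable abbrev relMatchingObj (n : ℕ) : D := pullback (matchingObjMap φ n) (matchingMap Y n)

/-- The relative matching map of a map of simplicial objects. -/
noncomputable def relMatchingMap (n : ℕ) : X.obj (op ⦋n⦌) ⟶ relMatchingObj φ n :=
  pullback.lift (matchingMap X n) (φ.app _) (matchingMap_naturality φ n)

@[simp]
lemma relMatchingMap_fst (n : ℕ) : relMatchingMap φ n ≫ pullback.fst _ _ = matchingMap X n :=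
  pullback.lift_fst _ _ _

@[simp]
lemma relMatchingMap_snd (n : ℕ) : relMatchingMap φ n ≫ pullback.snd _ _ = φ.app _ :=
  pullback.lift_snd _ _ _

/-- The map `M_n X ×_{M_n Y} Y_n ⟶ M_n X ×_{M_n Z} Z_n` comparing the relative matching objects of
`φ` and of `φ ≫ ψ`. -/
noncomputable def relMatchingObjPostcomp (n : ℕ) :
    relMatchingObj φ n ⟶ relMatchingObj (φ ≫ ψ) n :=
  pullback.lift (pullback.fst _ _) (pullback.snd _ _ ≫ ψ.app _) (by
    rw [Category.assoc, ← matchingMap_naturality, ← pullback.condition_assoc]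
    exact congrArg _ (Functor.map_comp _ _ _))

@[simp]
lemma relMatchingObjPostcomp_fst (n : ℕ) :
    relMatchingObjPostcomp φ ψ n ≫ pullback.fst _ _ = pullback.fst _ _ :=
  pullback.lift_fst _ _ _

@[simp]
lemma relMatchingObjPostcomp_snd (n : ℕ) :
    relMatchingObjPostcomp φ ψ n ≫ pullback.snd _ _ = pullback.snd _ _ ≫ ψ.app _ :=
  pullback.lift_snd _ _ _

/-- The map `M_n X ×_{M_n Z} Z_n ⟶ M_n Y ×_{M_n Z} Z_n` comparing the relative matching objects of
`φ ≫ ψ` and of `ψ`. -/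
noncomputable def relMatchingObjPrecomp (n : ℕ) : relMatchingObj (φ ≫ ψ) n ⟶ relMatchingObj ψ n :=
  pullback.map _ _ _ _ (matchingObjMap φ n) (𝟙 _) (𝟙 _)
    ((Category.comp_id _).trans (Functor.map_comp _ _ _))
    (by rw [Category.comp_id, Category.id_comp])

@[simp]
lemma relMatchingObjPrecomp_fst (n : ℕ) :
    relMatchingObjPrecomp φ ψ n ≫ pullback.fst _ _ = pullback.fst _ _ ≫ matchingObjMap φ n :=
  pullback.lift_fst _ _ _

@[simp]
lemma relMatchingObjPrecomp_snd (n : ℕ) :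
    relMatchingObjPrecomp φ ψ n ≫ pullback.snd _ _ = pullback.snd _ _ :=
  (pullback.lift_snd _ _ _).trans (Category.comp_id _)

lemma relMatchingMap_comp_postcomp (n : ℕ) :
    relMatchingMap φ n ≫ relMatchingObjPostcomp φ ψ n = relMatchingMap (φ ≫ ψ) n := by
  apply pullback.hom_ext <;> simp [reassoc_of% relMatchingMap_snd φ]

lemma relMatchingMap_comp_precomp (n : ℕ) :
    relMatchingMap (φ ≫ ψ) n ≫ relMatchingObjPrecomp φ ψ n = φ.app _ ≫ relMatchingMap ψ n := by
  apply pullback.hom_ext <;>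
    simp [reassoc_of% relMatchingMap_fst (φ ≫ ψ), matchingMap_naturality]

lemma isPullback_relMatchingObjPrecomp (n : ℕ) :
    IsPullback (relMatchingObjPrecomp φ ψ n) (pullback.fst _ _) (pullback.fst _ _)
      (matchingObjMap φ n) := by
  refine .of_right (h₁₂ := pullback.snd _ _) (h₂₂ := matchingObjMap ψ n) (v₁₃ := matchingMap Z n)
    ?_ (relMatchingObjPrecomp_fst φ ψ n) (IsPullback.of_hasPullback _ _).flip
  rw [relMatchingObjPrecomp_snd, ← Functor.map_comp]
  exact (IsPullback.of_hasPullback (matchingObjMap (φ ≫ ψ) n) (matchingMap Z n)).flip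

lemma isPullback_relMatchingObjPostcomp (n : ℕ) :
    IsPullback (pullback.snd _ _) (relMatchingObjPostcomp φ ψ n) (relMatchingMap ψ n)
      (relMatchingObjPrecomp φ ψ n) := by
  refine .of_bot (v₂₁ := pullback.fst _ _) (v₂₂ := pullback.fst _ _) (h₃₁ := matchingObjMap φ n)
    ?_ ?_ (isPullback_relMatchingObjPrecomp φ ψ n)
  · simpa using (IsPullback.of_hasPullback (matchingObjMap φ n) (matchingMap Y n)).flip
  · apply pullback.hom_ext <;>
      simp [reassoc_of% relMatchingObjPostcomp_fst φ ψ, pullback.condition]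

lemma isIso_relMatchingObjPrecomp (n : ℕ)
    (h : ∀ k : SimplexCategory, k.len < n → IsIso (φ.app (op k))) :
    IsIso (relMatchingObjPrecomp φ ψ n) := by
  have := isIso_matchingObjMap φ h
  unfold relMatchingObjPrecomp
  infer_instance

lemma isPullback_relMatchingMap {P Q : SimplicialObject D} {φ' : P ⟶ Q} {p : P ⟶ X} {q : Q ⟶ Y}
    (n : ℕ) (sq : IsPullback p φ' φ q) :
    ∃ r, IsPullback (p.app _) (relMatchingMap φ' n) (relMatchingMap φ n) r := by
  have sqn := sq.map ((evaluation _ D).obj (op ⦋n⦌))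
  have sqM := sq.map (matchingFunctor D n)
  let r : relMatchingObj φ' n ⟶ relMatchingObj φ n :=
    pullback.map _ _ _ _ (matchingObjMap p n) (q.app _) (matchingObjMap q n) sqM.w.symm
      (matchingMap_naturality q n)
  have r_fst : r ≫ pullback.fst _ _ = pullback.fst _ _ ≫ matchingObjMap p n :=
    pullback.lift_fst _ _ _
  have r_snd : r ≫ pullback.snd _ _ = pullback.snd _ _ ≫ q.app _ := pullback.lift_snd _ _ _
  have isPullback_r : IsPullback r (pullback.snd _ _) (pullback.snd _ _) (q.app _) := by
    refine .of_right (h₁₂ := pullback.fst _ _) (h₂₂ := matchingMap Y n)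
      (v₁₃ := matchingObjMap φ n) ?_ r_snd (IsPullback.of_hasPullback _ _)
    rw [r_fst, ← matchingMap_naturality]
    exact (IsPullback.of_hasPullback (matchingObjMap φ' n) (matchingMap Q n)).paste_horiz sqM
  refine ⟨r, .of_bot (by simpa using sqn) ?_ isPullback_r⟩
  apply pullback.hom_ext
  · simp [r_fst, reassoc_of% relMatchingMap_fst φ', matchingMap_naturality]
  · simpa [r_snd, reassoc_of% relMatchingMap_snd φ'] using sqn.w

end RelativeMatching

section ReedyFibration

variable [HasFiniteLimits D] (Fib : MorphismProperty D) {X Y Z : SimplicialObject D}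

/-- A map of simplicial objects is a Reedy fibration with respect to a class `Fib` if all its
relative matching maps belong to this class. -/
def ReedyFibration : MorphismProperty (SimplicialObject D) :=
  fun _ _ φ => ∀ n : ℕ, Fib (relMatchingMap φ n)

instance [Fib.IsStableUnderComposition] [Fib.IsStableUnderBaseChange] :
    (ReedyFibration Fib).IsStableUnderComposition where
  comp_mem φ ψ hφ hψ n := by
    rw [← relMatchingMap_comp_postcomp]
    exact Fib.comp_mem _ _ (hφ n)
      (Fib.of_isPullback (isPullback_relMatchingObjPostcomp φ ψ n) (hψ n))

instance [Fib.IsStableUnderBaseChange] : (ReedyFibration Fib).IsStableUnderBaseChange where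
  of_isPullback sq h n := by
    obtain ⟨r, hr⟩ := isPullback_relMatchingMap _ n sq
    exact Fib.of_isPullback hr (h n)

lemma relMatchingMap_mem_iff_of_isIso [Fib.RespectsIso] (φ : X ⟶ Y) (ψ : Y ⟶ Z) {n : ℕ}
    (h : ∀ k : SimplexCategory, k.len ≤ n → IsIso (φ.app (op k))) :
    Fib (relMatchingMap ψ n) ↔ Fib (relMatchingMap (φ ≫ ψ) n) := by
  have := h ⦋n⦌ le_rfl
  have := isIso_relMatchingObjPrecomp φ ψ n fun k hk => h k hk.le
  rw [← Fib.cancel_right_of_respectsIso _ (relMatchingObjPrecomp φ ψ n),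
    relMatchingMap_comp_precomp, Fib.cancel_left_of_respectsIso]

end ReedyFibration

end Matching

section EventuallyConstant

lemma isEventuallyConstantFrom_of_isIso_succ {C : Type u} [Category.{v} C] (F : ℕ ⥤ C) {m : ℕ}
    (h : ∀ n, m ≤ n → IsIso (F.map (homOfLE (Nat.le_add_right n 1)))) :
    F.IsEventuallyConstantFrom m := fun j f => by
  obtain ⟨d, rfl⟩ := Nat.exists_eq_add_of_le (leOfHom f)
  obtain rfl := Subsingleton.elim f (homOfLE (Nat.le_add_right m d))
  induction d with
  | zero => exact inferInstanceAs (IsIso (F.map (𝟙 m)))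
  | succ d ih =>
    have := IsIso.comp_isIso' ih (h (m + d) (by lia))
    rwa [← F.map_comp] at this

variable {D : Type u} [Category.{v} D] {F : ℕ ⥤ SimplicialObject D}
  (hF : ∀ (n : ℕ) (k : SimplexCategory), k.len < n →
    IsIso ((F.map (homOfLE (Nat.le_add_right n 1))).app (op k)))

include hF

lemma isEventuallyConstantFrom_comp_evaluation (k : SimplexCategoryᵒᵖ) :
    (F ⋙ (evaluation _ _).obj k).IsEventuallyConstantFrom (k.unop.len + 1) :=
  isEventuallyConstantFrom_of_isIso_succ _ fun n hn => hF n k.unop hn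

lemma hasColimit_of_isIso_app_succ : HasColimit F := by
  have (k : SimplexCategoryᵒᵖ) : HasColimit (F.flip.obj k) :=
    (isEventuallyConstantFrom_comp_evaluation hF k).hasColimit
  exact functorCategoryHasColimit F

lemma isIso_colimit_ι_app [HasColimit F] {n : ℕ} {k : SimplexCategory} (hk : k.len < n) :
    IsIso ((colimit.ι F n).app (op k)) := by
  have (k : SimplexCategoryᵒᵖ) : HasColimit (F.flip.obj k) :=
    (isEventuallyConstantFrom_comp_evaluation hF k).hasColimit
  exact (isEventuallyConstantFrom_comp_evaluation hF (op k)).isIso_ι_of_isColimit'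
    (isColimitOfPreserves ((evaluation _ _).obj (op k)) (colimit.isColimit F)) n (homOfLE hk)

end EventuallyConstant

section ReedyFactorization

open Simplicial

variable {D : Type u} [Category.{v} D] [HasFiniteLimits D]

/-- A factorization of the `n`-th relative matching map of `ψ`. It determines a factorization of
`ψ` through the simplicial object `attach` obtained from the source of `ψ` by enlarging the object
in degree `n`, and adding the degeneracies of the new `n`-simplices freely. -/
structure RelMatchingFactorization {Y B : SimplicialObject D} (ψ : Y ⟶ B) (n : ℕ) where
  /-- the middle object -/
  Z : D
  /-- the first map -/
  t : Y.obj (op ⦋n⦌) ⟶ Z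
  /-- the second map -/
  p : Z ⟶ relMatchingObj ψ n
  fac : t ≫ p = relMatchingMap ψ n

namespace RelMatchingFactorization

variable [HasFiniteColimits D] {Y B : SimplicialObject D} {ψ : Y ⟶ B} {n : ℕ}
  (A : RelMatchingFactorization ψ n) {k l : SimplexCategory} {W : D}

/-- The degree `k` part of `attach`: a copy of `A.Z` is glued to `Y_k` for each degeneracy
operator `k ⟶ ⦋n⦌`. -/
noncomputable abbrev attachObj (k : SimplexCategory) : D :=
  pushout (Limits.Sigma.desc fun θ : {θ : k ⟶ ⦋n⦌ // Epi θ} => Y.map θ.1.op)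
    (Limits.Sigma.map fun _ : {θ : k ⟶ ⦋n⦌ // Epi θ} => A.t)

/-- The inclusion of the original simplicial object in degree `k`. -/
noncomputable def inclObj (k : SimplexCategory) : Y.obj (op k) ⟶ A.attachObj k := pushout.inl _ _

/-- The pullback of the universal new `n`-simplex along the operator `θ`. -/
noncomputable def simplex (θ : k ⟶ ⦋n⦌) : A.Z ⟶ A.attachObj k :=
  open Classical in
  if hθ : Epi θ then
    Sigma.ι (fun _ : {θ : k ⟶ ⦋n⦌ // Epi θ} => A.Z) ⟨θ, hθ⟩ ≫ pushout.inr _ _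
  else A.p ≫ pullback.fst _ _ ≫ matchingEval Y θ hθ ≫ A.inclObj k

lemma simplex_of_epi (θ : k ⟶ ⦋n⦌) (hθ : Epi θ) :
    A.simplex θ = Sigma.ι (fun _ : {θ : k ⟶ ⦋n⦌ // Epi θ} => A.Z) ⟨θ, hθ⟩ ≫ pushout.inr _ _ :=
  dif_pos hθ

lemma simplex_of_not_epi (θ : k ⟶ ⦋n⦌) (hθ : ¬ Epi θ) :
    A.simplex θ = A.p ≫ pullback.fst _ _ ≫ matchingEval Y θ hθ ≫ A.inclObj k :=
  dif_neg hθ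

lemma t_simplex (θ : k ⟶ ⦋n⦌) : A.t ≫ A.simplex θ = Y.map θ.op ≫ A.inclObj k := by
  by_cases hθ : Epi θ
  · have glue := Sigma.ι (fun _ : {θ : k ⟶ ⦋n⦌ // Epi θ} => Y.obj (op ⦋n⦌)) ⟨θ, hθ⟩ ≫=
      pushout.condition (f := Limits.Sigma.desc fun θ : {θ : k ⟶ ⦋n⦌ // Epi θ} => Y.map θ.1.op)
        (g := Limits.Sigma.map fun _ : {θ : k ⟶ ⦋n⦌ // Epi θ} => A.t)
    rw [Sigma.ι_desc_assoc, Sigma.ι_map_assoc] at glue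
    rw [A.simplex_of_epi θ hθ]
    exact glue.symm
  · rw [A.simplex_of_not_epi θ hθ, reassoc_of% A.fac, reassoc_of% relMatchingMap_fst,
      reassoc_of% @matchingMap_eval]

lemma attachObj_hom_ext {f g : A.attachObj k ⟶ W} (h₁ : A.inclObj k ≫ f = A.inclObj k ≫ g)
    (h₂ : ∀ θ : k ⟶ ⦋n⦌, Epi θ → A.simplex θ ≫ f = A.simplex θ ≫ g) : f = g :=
  pushout.hom_ext h₁ <| Sigma.hom_ext _ _ fun ⟨θ, hθ⟩ => by
    simpa only [A.simplex_of_epi θ hθ, Category.assoc] using h₂ θ hθ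

/-- The map out of `attachObj` given by a map on `Y_k` and a map on each new simplex. -/
noncomputable def attachDesc (a : Y.obj (op k) ⟶ W) (b : (k ⟶ ⦋n⦌) → (A.Z ⟶ W))
    (h : ∀ θ : k ⟶ ⦋n⦌, Epi θ → A.t ≫ b θ = Y.map θ.op ≫ a) : A.attachObj k ⟶ W :=
  pushout.desc a (Limits.Sigma.desc fun θ => b θ.1)
    (Sigma.hom_ext _ _ fun ⟨θ, hθ⟩ => by simp [h θ hθ])

section

variable (a : Y.obj (op k) ⟶ W) (b : (k ⟶ ⦋n⦌) → (A.Z ⟶ W))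
  (h : ∀ θ : k ⟶ ⦋n⦌, Epi θ → A.t ≫ b θ = Y.map θ.op ≫ a)

@[simp]
lemma inclObj_attachDesc : A.inclObj k ≫ A.attachDesc a b h = a :=
  pushout.inl_desc _ _ _

lemma simplex_attachDesc_of_epi (θ : k ⟶ ⦋n⦌) (hθ : Epi θ) :
    A.simplex θ ≫ A.attachDesc a b h = b θ := by
  rw [A.simplex_of_epi θ hθ, attachDesc, Category.assoc, pushout.inr_desc, Sigma.ι_desc]

lemma simplex_attachDesc
    (h' : ∀ (θ : k ⟶ ⦋n⦌) (hθ : ¬ Epi θ),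
      A.p ≫ pullback.fst _ _ ≫ matchingEval Y θ hθ ≫ a = b θ) (θ : k ⟶ ⦋n⦌) :
    A.simplex θ ≫ A.attachDesc a b h = b θ := by
  by_cases hθ : Epi θ
  · exact A.simplex_attachDesc_of_epi a b h θ hθ
  · simp only [A.simplex_of_not_epi θ hθ, Category.assoc, inclObj_attachDesc, h' θ hθ]

end

/-- The structure maps of `attach`. -/
noncomputable def attachMap (α : l ⟶ k) : A.attachObj k ⟶ A.attachObj l :=
  A.attachDesc (Y.map α.op ≫ A.inclObj l) (fun θ => A.simplex (α ≫ θ)) fun θ _ => by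
    rw [t_simplex, op_comp, Y.map_comp, Category.assoc]

@[simp]
lemma inclObj_attachMap (α : l ⟶ k) :
    A.inclObj k ≫ A.attachMap α = Y.map α.op ≫ A.inclObj l :=
  A.inclObj_attachDesc _ _ _

@[simp]
lemma simplex_attachMap (α : l ⟶ k) (θ : k ⟶ ⦋n⦌) :
    A.simplex θ ≫ A.attachMap α = A.simplex (α ≫ θ) :=
  A.simplex_attachDesc _ _ _ (fun θ hθ => by
    rw [reassoc_of% @matchingEval_map, A.simplex_of_not_epi _ (not_epi_comp hθ α)]) θ

/-- The simplicial object obtained by gluing the middle object of the factorization to `Y` in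
degree `n`. -/
noncomputable abbrev attach : SimplicialObject D where
  obj k := A.attachObj k.unop
  map α := A.attachMap α.unop
  map_id k := A.attachObj_hom_ext (by simp) (by simp)
  map_comp α β := A.attachObj_hom_ext
    (by simp [reassoc_of% A.inclObj_attachMap]) (by simp [reassoc_of% A.simplex_attachMap])

/-- The inclusion of the original simplicial object. -/
noncomputable def incl : Y ⟶ A.attach where
  app k := A.inclObj k.unop
  naturality _ _ α := (A.inclObj_attachMap α.unop).symm

/-- The map `attach ⟶ B` in degree `k`. -/
noncomputable def descObj (k : SimplexCategory) : A.attachObj k ⟶ B.obj (op k) :=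
  A.attachDesc (ψ.app (op k)) (fun θ => A.p ≫ pullback.snd _ _ ≫ B.map θ.op) fun θ _ => by
    rw [reassoc_of% A.fac, reassoc_of% relMatchingMap_snd, ψ.naturality]

@[simp]
lemma inclObj_descObj (k : SimplexCategory) : A.inclObj k ≫ A.descObj k = ψ.app (op k) :=
  A.inclObj_attachDesc _ _ _

@[simp]
lemma simplex_descObj (θ : k ⟶ ⦋n⦌) :
    A.simplex θ ≫ A.descObj k = A.p ≫ pullback.snd _ _ ≫ B.map θ.op :=
  A.simplex_attachDesc _ _ _ (fun θ hθ => by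
    rw [← matchingObjMap_eval, pullback.condition_assoc, matchingMap_eval]) θ

/-- The map `attach ⟶ B` extending `ψ`. -/
noncomputable def desc : A.attach ⟶ B where
  app k := A.descObj k.unop
  naturality k l α := A.attachObj_hom_ext
    (by simp [reassoc_of% A.inclObj_attachMap, reassoc_of% A.inclObj_descObj])
    (by simp [reassoc_of% A.simplex_attachMap, reassoc_of% A.simplex_descObj])

lemma incl_desc : A.incl ≫ A.desc = ψ := by
  ext k
  exact A.inclObj_descObj k.unop

lemma isIso_incl_app (hk : k.len < n) : IsIso (A.incl.app (op k)) := by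
  have not_epi (θ : k ⟶ ⦋n⦌) : ¬ Epi θ := fun _ =>
    hk.not_ge (SimplexCategory.len_le_of_epi θ)
  exact ⟨A.attachDesc (𝟙 _) (fun θ => A.p ≫ pullback.fst _ _ ≫ matchingEval Y θ (not_epi θ))
      fun θ hθ => (not_epi θ hθ).elim,
    A.inclObj_attachDesc _ _ _,
    A.attachObj_hom_ext
      (((reassoc_of% A.inclObj_attachDesc) _ _ _ _).trans
        ((Category.id_comp _).trans (Category.comp_id _).symm))
      fun θ hθ => (not_epi θ hθ).elim⟩

lemma isIso_simplex_id : IsIso (A.simplex (𝟙 ⦋n⦌)) := by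
  have eq_id (θ : ⦋n⦌ ⟶ ⦋n⦌) (_ : Epi θ) : θ = 𝟙 _ := SimplexCategory.eq_id_of_epi θ
  refine ⟨A.attachDesc A.t (fun _ => 𝟙 _) (fun θ hθ => by simp [eq_id θ hθ]),
    A.simplex_attachDesc_of_epi _ _ _ _ inferInstance, A.attachObj_hom_ext ?_ fun θ hθ => ?_⟩
  · simp [t_simplex, reassoc_of% A.inclObj_attachDesc]
  · rw [← Category.assoc, A.simplex_attachDesc_of_epi _ _ _ _ hθ, eq_id θ hθ, Category.id_comp,
      Category.comp_id]

lemma llp_incl_app (P : MorphismProperty D) (ht : P.llp A.t) (k : SimplexCategoryᵒᵖ) :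
    P.llp (A.incl.app k) := fun E F p hp => by
  have := ht p hp
  refine ⟨fun {f g} sq => ?_⟩
  have w : f ≫ p = A.inclObj k.unop ≫ g := sq.w
  have sqZ (θ : k.unop ⟶ ⦋n⦌) : CommSq (Y.map θ.op ≫ f) A.t p (A.simplex θ ≫ g) :=
    ⟨by rw [Category.assoc, w, reassoc_of% A.t_simplex]⟩
  exact ⟨⟨⟨A.attachDesc f (fun θ => (sqZ θ).lift) fun θ _ => (sqZ θ).fac_left,
    A.inclObj_attachDesc _ _ _,
    A.attachObj_hom_ext (((reassoc_of% A.inclObj_attachDesc) _ _ _ _).trans w) fun θ hθ => by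
      rw [← Category.assoc, A.simplex_attachDesc_of_epi _ _ _ _ hθ, (sqZ θ).fac_right]⟩⟩⟩

lemma simplex_id_matchingMap :
    A.simplex (𝟙 ⦋n⦌) ≫ matchingMap A.attach n =
      A.p ≫ pullback.fst _ _ ≫ matchingObjMap A.incl n :=
  matchingObj_hom_ext fun k μ hμ => by
    have simplex_face : A.simplex (𝟙 ⦋n⦌) ≫ A.attach.map μ.op = A.simplex μ :=
      (A.simplex_attachMap μ (𝟙 ⦋n⦌)).trans (by rw [Category.comp_id])
    simp only [Category.assoc, matchingMap_π, matchingObjMap_π, simplex_face,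
      A.simplex_of_not_epi μ (not_epi_of_properFaces hμ), matchingEval_of_properFaces Y μ hμ]
    rfl

lemma relMatchingMap_desc_mem (Fib : MorphismProperty D) [Fib.RespectsIso] (hp : Fib A.p) :
    Fib (relMatchingMap A.desc n) := by
  have := isIso_matchingObjMap A.incl fun k hk => A.isIso_incl_app hk
  have := A.isIso_simplex_id
  let κ : relMatchingObj ψ n ⟶ relMatchingObj A.desc n :=
    pullback.map _ _ _ _ (matchingObjMap A.incl n) (𝟙 _) (𝟙 _)
      (by rw [Category.comp_id, ← Functor.map_comp, incl_desc])
      (by rw [Category.comp_id, Category.id_comp])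
  have fac : A.simplex (𝟙 ⦋n⦌) ≫ relMatchingMap A.desc n = A.p ≫ κ := by
    apply pullback.hom_ext
    · rw [Category.assoc, Category.assoc, relMatchingMap_fst, simplex_id_matchingMap,
        pullback.lift_fst]
    · rw [Category.assoc, Category.assoc, relMatchingMap_snd, pullback.lift_snd, Category.comp_id]
      exact (A.simplex_descObj (𝟙 ⦋n⦌)).trans (by simp)
  rw [← Fib.cancel_left_of_respectsIso (A.simplex (𝟙 ⦋n⦌)), fac,
    Fib.cancel_right_of_respectsIso]
  exact hp

end RelMatchingFactorization

section

variable [HasFiniteColimits D] (Fib : MorphismProperty D) [Fib.RespectsIso]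
  (good : ObjectProperty D)
  (hfac : ∀ {X Y : D} (f : X ⟶ Y), good X →
    ∃ (Z : D) (i : X ⟶ Z) (p : Z ⟶ Y), Fib.llp i ∧ Fib p ∧ i ≫ p = f)
  (hgood : ∀ {X Y : D} (i : X ⟶ Y), good X → Fib.llp i → good Y)
  {Y B : SimplicialObject D} (ψ : Y ⟶ B) (hY : ∀ k, good (Y.obj k))

include hfac hgood hY

lemma exists_reedyTower :
    ∃ (F : ℕ ⥤ Over B) (i : Over.mk ψ ⟶ F.obj 0), (∀ k, Fib.llp (i.left.app k)) ∧
      (∀ n k, Fib.llp ((F.map (homOfLE (Nat.le_add_right n 1))).left.app k)) ∧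
      (∀ (n : ℕ) (k : SimplexCategory), k.len < n →
        IsIso ((F.map (homOfLE (Nat.le_add_right n 1))).left.app (op k))) ∧
      ∀ n, Fib (relMatchingMap (F.obj (n + 1)).hom n) := by
  have step (n : ℕ) (s : {p : Over B // ∀ k, good (p.left.obj k)}) :
      ∃ (s' : {p : Over B // ∀ k, good (p.left.obj k)}) (ι : s.1 ⟶ s'.1),
        (∀ k, Fib.llp (ι.left.app k)) ∧
        (∀ k : SimplexCategory, k.len < n → IsIso (ι.left.app (op k))) ∧
        Fib (relMatchingMap s'.1.hom n) := by
    obtain ⟨Z, t, p, ht, hp, fac⟩ := hfac (relMatchingMap s.1.hom n) (s.2 _)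
    let A : RelMatchingFactorization s.1.hom n := ⟨Z, t, p, fac⟩
    exact ⟨⟨Over.mk A.desc, fun k => hgood _ (s.2 k) (A.llp_incl_app Fib ht k)⟩,
      Over.homMk A.incl A.incl_desc, A.llp_incl_app Fib ht, fun k hk => A.isIso_incl_app hk,
      A.relMatchingMap_desc_mem Fib hp⟩
  choose next ι llp_ι isIso_ι fib_next using step
  let s : ℕ → {p : Over B // ∀ k, good (p.left.obj k)} := fun n => Nat.rec ⟨Over.mk ψ, hY⟩ next n
  refine ⟨Functor.ofSequence (X := fun n => (s n).1) fun n => ι n (s n), 𝟙 _,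
    fun k => Fib.llp.id_mem _, fun n k => ?_, fun n k hk => ?_, fun n => fib_next n (s n)⟩
  · rw [Functor.ofSequence_map_homOfLE_succ]
    exact llp_ι n (s n) k
  · rw [Functor.ofSequence_map_homOfLE_succ]
    exact isIso_ι n (s n) k hk

theorem exists_reedy_factorization :
    ∃ (X : SimplicialObject D) (ι : Y ⟶ X) (π : X ⟶ B), ι ≫ π = ψ ∧
      (∀ k, Fib.llp (ι.app k)) ∧ ReedyFibration Fib π := by
  obtain ⟨F, i, llp_i, llp_F, isIso_F, fib_F⟩ := exists_reedyTower Fib good hfac hgood ψ hY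
  have := hasColimit_of_isIso_app_succ (F := F ⋙ Over.forget B) isIso_F
  let j (n : ℕ) : (F.obj n).left ⟶ colimit (F ⋙ Over.forget B) :=
    colimit.ι (F ⋙ Over.forget B) n
  have isIso_j {n : ℕ} {k : SimplexCategory} (hk : k.len < n) : IsIso ((j n).app (op k)) :=
    isIso_colimit_ι_app (F := F ⋙ Over.forget B) isIso_F hk
  let π : colimit (F ⋙ Over.forget B) ⟶ B := colimit.desc _ (Over.forgetCocone B |>.whisker F)
  have j_π (n : ℕ) : j n ≫ π = (F.obj n).hom := colimit.ι_desc _ _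
  have llp_map (n : ℕ) (k) : Fib.llp ((F.map (homOfLE (Nat.zero_le n))).left.app k) := by
    induction n with
    | zero =>
      have := Fib.llp.id_mem ((F.obj 0).left.obj k)
      rwa [← NatTrans.id_app, ← Over.id_left, ← F.map_id] at this
    | succ n ih =>
      have := Fib.llp.comp_mem _ _ ih (llp_F n k)
      rwa [← NatTrans.comp_app, ← Over.comp_left, ← F.map_comp] at this
  refine ⟨_, i.left ≫ j 0, π, ?_, fun k => Fib.llp.comp_mem _ _ (llp_i k) ?_, fun n => ?_⟩
  · rw [Category.assoc, j_π]
    exact Over.w i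
  · have : IsIso ((j (k.unop.len + 1)).app k) := isIso_j (Nat.lt_succ_self _)
    have j_w : (F.map (homOfLE (Nat.zero_le (k.unop.len + 1)))).left ≫ j _ = j 0 :=
      colimit.w (F ⋙ Over.forget B) _
    rw [← j_w]
    exact (Fib.llp.cancel_right_of_respectsIso _ _).2 (llp_map _ k)
  · rw [relMatchingMap_mem_iff_of_isIso Fib (j (n + 1)) π fun k hk => isIso_j (by lia), j_π]
    exact fib_F n

end

end ReedyFactorization

section HomComplex

open Simplicial

variable {D : Type u} [Category.{v} D] {U V : D} {A B C : SimplicialObject D} {n : ℕ}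
  {k l : SimplexCategory}

/-- The simplicial set `D(X, A_•)`. -/
abbrev homSSet (X : D) (A : SimplicialObject D) : SSet.{v} :=
  ((SimplicialObject.whiskering D (Type v)).obj (coyoneda.obj (op X))).obj A

/-- The map `D(V, A_•) ⟶ D(U, A_•)` induced by `i : U ⟶ V`. -/
abbrev homPrecomp (i : U ⟶ V) (A : SimplicialObject D) : homSSet V A ⟶ homSSet U A :=
  ((SimplicialObject.whiskering D (Type v)).map (coyoneda.map i.op)).app A

lemma homMap_comp (X : D) (φ : A ⟶ B) (ψ : B ⟶ C) :
    homMap X (φ ≫ ψ) = homMap X φ ≫ homMap X ψ :=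
  CategoryTheory.Functor.map_comp _ _ _

/-- The Yoneda bijection for `D(X, A_•)`. -/
def simplexEquiv (X : D) (A : SimplicialObject D) (n : ℕ) :
    (Δ[n] ⟶ homSSet X A) ≃ (X ⟶ A.obj (op ⦋n⦌)) := SSet.yonedaEquiv

lemma simplexEquiv_homMap (φ : A ⟶ B) (g : Δ[n] ⟶ homSSet U A) :
    simplexEquiv U B n (g ≫ homMap U φ) = simplexEquiv U A n g ≫ φ.app (op ⦋n⦌) := rfl

lemma simplexEquiv_homPrecomp (i : U ⟶ V) (g : Δ[n] ⟶ homSSet V A) :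
    simplexEquiv U A n (g ≫ homPrecomp i A) = i ≫ simplexEquiv V A n g := rfl

lemma not_epi_of_mem_boundary {x : Δ[n].obj (op k)}
    (hx : x ∈ (SSet.boundary.{v} n).obj (op k)) : ¬ Epi (SSet.stdSimplex.objEquiv x) := by
  rw [SimplexCategory.epi_iff_surjective]
  exact hx

/-- The simplex of `∂Δ[n]` given by an operator which is not surjective. -/
def boundarySimplex (θ : k ⟶ ⦋n⦌) (hθ : ¬ Epi θ) : (SSet.boundary.{v} n : SSet.{v}).obj (op k) :=
  ⟨SSet.stdSimplex.objEquiv.symm θ, by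
    rw [SimplexCategory.epi_iff_surjective] at hθ
    exact hθ⟩

/-- The value of a map `∂Δ[n] ⟶ D(V, A_•)` on a simplex of the boundary. -/
def boundaryEval (g : (SSet.boundary.{v} n : SSet.{v}) ⟶ homSSet V A) (θ : k ⟶ ⦋n⦌)
    (hθ : ¬ Epi θ) : V ⟶ A.obj (op k) :=
  g.app (op k) (boundarySimplex θ hθ)

lemma boundaryEval_map (g : (SSet.boundary.{v} n : SSet.{v}) ⟶ homSSet V A) (θ : k ⟶ ⦋n⦌)
    (hθ : ¬ Epi θ) (α : l ⟶ k) :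
    boundaryEval g θ hθ ≫ A.map α.op = boundaryEval g (α ≫ θ) (not_epi_comp hθ α) :=
  (ConcreteCategory.congr_hom (C := Type v) (g.naturality α.op) _).symm

lemma boundary_hom_ext {g g' : (SSet.boundary.{v} n : SSet.{v}) ⟶ homSSet V A}
    (h : ∀ (k : SimplexCategory) (θ : k ⟶ ⦋n⦌) (hθ : ¬ Epi θ),
      boundaryEval g θ hθ = boundaryEval g' θ hθ) : g = g' := by
  ext k x
  exact h _ (SSet.stdSimplex.objEquiv x.1) (not_epi_of_mem_boundary x.2)

lemma boundaryEval_ι_comp (g : Δ[n] ⟶ homSSet V A) (θ : k ⟶ ⦋n⦌) (hθ : ¬ Epi θ) :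
    boundaryEval ((SSet.boundary.{v} n).ι ≫ g) θ hθ = simplexEquiv V A n g ≫ A.map θ.op := by
  have map_id : Δ[n].map θ.op (SSet.stdSimplex.objEquiv.symm (𝟙 ⦋n⦌)) =
      SSet.stdSimplex.objEquiv.symm θ :=
    SSet.stdSimplex.objEquiv.injective (Category.comp_id θ)
  exact (congrArg (g.app (op k)) map_id.symm).trans
    (ConcreteCategory.congr_hom (C := Type v) (g.naturality θ.op) _)

/-- The map `D(V, A) ⟶ D(U, A) ×_{D(U, B)} D(V, B)`. -/
noncomputable def pullbackHom (i : U ⟶ V) (φ : A ⟶ B) :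
    homSSet V A ⟶ pullback (homMap U φ) (homPrecomp i B) :=
  pullback.lift (homPrecomp i A) (homMap V φ)
    (((SimplicialObject.whiskering D (Type v)).map (coyoneda.map i.op)).naturality φ).symm

@[simp]
lemma pullbackHom_fst (i : U ⟶ V) (φ : A ⟶ B) :
    pullbackHom i φ ≫ pullback.fst _ _ = homPrecomp i A := pullback.lift_fst _ _ _

@[simp]
lemma pullbackHom_snd (i : U ⟶ V) (φ : A ⟶ B) :
    pullbackHom i φ ≫ pullback.snd _ _ = homMap V φ := pullback.lift_snd _ _ _

variable [HasFiniteLimits D]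

lemma matchingObj_hom_ext_eval {f g : V ⟶ matchingObj A n}
    (h : ∀ (k : SimplexCategory) (θ : k ⟶ ⦋n⦌) (hθ : ¬ Epi θ),
      f ≫ matchingEval A θ hθ = g ≫ matchingEval A θ hθ) : f = g :=
  matchingObj_hom_ext fun k μ hμ => by
    simpa only [matchingEval_of_properFaces A μ hμ] using h k μ (not_epi_of_properFaces hμ)

/-- The map to the matching object given by a map out of `∂Δ[n]`. -/
noncomputable def boundaryToMatching (g : (SSet.boundary.{v} n : SSet.{v}) ⟶ homSSet V A) :
    V ⟶ matchingObj A n :=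
  matchingLift (fun _ μ hμ => boundaryEval g μ (not_epi_of_properFaces hμ))
    fun _ _ _ _ _ _ => boundaryEval_map _ _ _ _

lemma boundaryToMatching_eval (g : (SSet.boundary.{v} n : SSet.{v}) ⟶ homSSet V A) (θ : k ⟶ ⦋n⦌)
    (hθ : ¬ Epi θ) : boundaryToMatching g ≫ matchingEval A θ hθ = boundaryEval g θ hθ := by
  rw [matchingEval, boundaryToMatching, reassoc_of% @matchingLift_π, boundaryEval_map]
  simp only [image.fac]

/-- Maps from `∂Δ[n]` to `D(V, A_•)` are maps from `V` to the matching object. -/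
noncomputable def boundaryEquiv (V : D) (A : SimplicialObject D) (n : ℕ) :
    ((SSet.boundary.{v} n : SSet.{v}) ⟶ homSSet V A) ≃ (V ⟶ matchingObj A n) where
  toFun := boundaryToMatching
  invFun d :=
    { app k := ↾(fun x => (d ≫ matchingEval A (SSet.stdSimplex.objEquiv x.1)
        (not_epi_of_mem_boundary x.2) : V ⟶ A.obj k))
      naturality k l α := by
        ext x
        exact (congrArg (d ≫ ·) (matchingEval_map A (SSet.stdSimplex.objEquiv x.1)
          (not_epi_of_mem_boundary x.2) α.unop).symm).trans (Category.assoc _ _ _).symm }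
  left_inv g := boundary_hom_ext fun _ θ hθ => boundaryToMatching_eval g θ hθ
  right_inv _ := matchingObj_hom_ext_eval fun _ _ _ => boundaryToMatching_eval _ _ _

lemma boundaryEquiv_eval (g : (SSet.boundary.{v} n : SSet.{v}) ⟶ homSSet V A) (θ : k ⟶ ⦋n⦌)
    (hθ : ¬ Epi θ) : boundaryEquiv V A n g ≫ matchingEval A θ hθ = boundaryEval g θ hθ :=
  boundaryToMatching_eval g θ hθ

lemma boundaryEquiv_homMap (φ : A ⟶ B) (g : (SSet.boundary.{v} n : SSet.{v}) ⟶ homSSet V A) :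
    boundaryEquiv V B n (g ≫ homMap V φ) = boundaryEquiv V A n g ≫ matchingObjMap φ n :=
  matchingObj_hom_ext_eval fun k θ hθ => by
    rw [Category.assoc, matchingObjMap_eval, ← Category.assoc, boundaryEquiv_eval,
      boundaryEquiv_eval]
    rfl

lemma boundaryEquiv_homPrecomp (i : U ⟶ V)
    (g : (SSet.boundary.{v} n : SSet.{v}) ⟶ homSSet V A) :
    boundaryEquiv U A n (g ≫ homPrecomp i A) = i ≫ boundaryEquiv V A n g :=
  matchingObj_hom_ext_eval fun k θ hθ => by
    rw [Category.assoc, boundaryEquiv_eval, boundaryEquiv_eval]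
    rfl

lemma boundaryEquiv_ι_comp (g : Δ[n] ⟶ homSSet V A) :
    boundaryEquiv V A n ((SSet.boundary.{v} n).ι ≫ g) = simplexEquiv V A n g ≫ matchingMap A n :=
  matchingObj_hom_ext_eval fun k θ hθ => by
    rw [Category.assoc, boundaryEquiv_eval, matchingMap_eval, boundaryEval_ι_comp]

variable (i : U ⟶ V) (φ : A ⟶ B)

lemma hasLiftingProperty_pullbackHom [HasLiftingProperty i (relMatchingMap φ n)] :
    HasLiftingProperty (SSet.boundary.{v} n).ι (pullbackHom i φ) where
  sq_hasLift {f g} sq := by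
    have w₁ := sq.w =≫ pullback.fst _ _
    have w₂ := sq.w =≫ pullback.snd _ _
    simp only [Category.assoc, pullbackHom_fst, pullbackHom_snd] at w₁ w₂
    let a := simplexEquiv U A n (g ≫ pullback.fst _ _)
    let b := simplexEquiv V B n (g ≫ pullback.snd _ _)
    have w : boundaryEquiv V A n f ≫ matchingObjMap φ n = b ≫ matchingMap B n := by
      rw [← boundaryEquiv_homMap, w₂, boundaryEquiv_ι_comp]
    have sq' : CommSq a i (relMatchingMap φ n) (pullback.lift (boundaryEquiv V A n f) b w) := ⟨by
      apply pullback.hom_ext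
      · rw [Category.assoc, Category.assoc, relMatchingMap_fst, pullback.lift_fst,
          ← boundaryEquiv_homPrecomp, w₁, boundaryEquiv_ι_comp]
      · rw [Category.assoc, Category.assoc, relMatchingMap_snd, pullback.lift_snd,
          ← simplexEquiv_homMap, ← simplexEquiv_homPrecomp, Category.assoc, Category.assoc,
          pullback.condition]⟩
    have lift_matchingMap : sq'.lift ≫ matchingMap A n = boundaryEquiv V A n f := by
      rw [← relMatchingMap_fst φ n, sq'.fac_right_assoc, pullback.lift_fst]
    have lift_app : sq'.lift ≫ φ.app _ = b := by
      rw [← relMatchingMap_snd φ n, sq'.fac_right_assoc, pullback.lift_snd]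
    refine ⟨⟨⟨(simplexEquiv V A n).symm sq'.lift, ?_, pullback.hom_ext ?_ ?_⟩⟩⟩
    · apply (boundaryEquiv V A n).injective
      rw [boundaryEquiv_ι_comp, Equiv.apply_symm_apply, lift_matchingMap]
    · apply (simplexEquiv _ _ n).injective
      rw [Category.assoc, pullbackHom_fst, simplexEquiv_homPrecomp, Equiv.apply_symm_apply,
        sq'.fac_left]
    · apply (simplexEquiv _ _ n).injective
      rw [Category.assoc, pullbackHom_snd, simplexEquiv_homMap, Equiv.apply_symm_apply, lift_app]

lemma hasLiftingProperty_bot_boundary {E F : SSet.{v}} (p : E ⟶ F) (n : ℕ)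
    (h : ∀ m < n, HasLiftingProperty (SSet.boundary.{v} m).ι p) :
    HasLiftingProperty (SSet.Subcomplex.ι (⊥ : (SSet.boundary.{v} n : SSet.{v}).Subcomplex)) p := by
  let I : MorphismProperty SSet.{v} := .ofHoms (fun m : Fin n => (SSet.boundary.{v} m).ι)
  have hp : I.rlp p := by
    rintro _ _ _ ⟨m⟩
    exact h m m.2
  -- the boundary is built from cells of dimension less than `n`
  let c := SSet.relativeCellComplex (SSet.boundary.{v} n : SSet.{v})
  have hc := c.transfiniteCompositionOfShape' (I := I) fun s => by
    have hs : s.j < n := by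
      by_contra! hlt
      have nonDegenerate := s.k.nonDegenerate
      rwa [SSet.nonDegenerate_eq_empty_of_hasDimensionLT _ n s.j hlt] at nonDegenerate
    exact ⟨(⟨s.j, hs⟩ : Fin n)⟩
  exact MorphismProperty.transfiniteCompositionsOfShape_pushouts_coproducts_le_llp_rlp.{v} I ℕ _
    hc.mem p hp

lemma hasLiftingProperty_matchingObjMap
    (h : ∀ m < n, HasLiftingProperty i (relMatchingMap φ m)) :
    HasLiftingProperty i (matchingObjMap φ n) where
  sq_hasLift {a b} sq := by
    have := hasLiftingProperty_bot_boundary (pullbackHom i φ) n fun m hm =>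
      have := h m hm
      hasLiftingProperty_pullbackHom i φ
    let g : (SSet.boundary.{v} n : SSet.{v}) ⟶ pullback (homMap U φ) (homPrecomp i B) :=
      pullback.lift ((boundaryEquiv U A n).symm a) ((boundaryEquiv V B n).symm b) (by
        apply (boundaryEquiv U B n).injective
        rw [boundaryEquiv_homMap, boundaryEquiv_homPrecomp, Equiv.apply_symm_apply,
          Equiv.apply_symm_apply, sq.w])
    have sq' : CommSq (SSet.Subcomplex.isInitialBot.to _)
      (SSet.Subcomplex.ι (⊥ : (SSet.boundary.{v} n : SSet.{v}).Subcomplex)) (pullbackHom i φ) g :=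
      ⟨SSet.Subcomplex.isInitialBot.hom_ext _ _⟩
    have lift_homPrecomp : sq'.lift ≫ homPrecomp i A = (boundaryEquiv U A n).symm a := by
      rw [← pullbackHom_fst i φ, sq'.fac_right_assoc, pullback.lift_fst]
    have lift_homMap : sq'.lift ≫ homMap V φ = (boundaryEquiv V B n).symm b := by
      rw [← pullbackHom_snd i φ, sq'.fac_right_assoc, pullback.lift_snd]
    refine ⟨⟨⟨boundaryEquiv V A n sq'.lift, ?_, ?_⟩⟩⟩
    · rw [← boundaryEquiv_homPrecomp, lift_homPrecomp, Equiv.apply_symm_apply]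
    · rw [← boundaryEquiv_homMap, lift_homMap, Equiv.apply_symm_apply]

lemma hasLiftingProperty_homMap {X : D} (hU : IsInitial U)
    [HasLiftingProperty (hU.to X) (relMatchingMap φ n)] :
    HasLiftingProperty (SSet.boundary.{v} n).ι (homMap X φ) := by
  have := hasLiftingProperty_pullbackHom (n := n) (hU.to X) φ
  have (k : SimplexCategoryᵒᵖ) : IsIso ((homMap U φ).app k) := by
    rw [isIso_iff_bijective]
    exact ⟨fun _ _ _ => hU.hom_ext _ _, fun _ => ⟨hU.to _, hU.hom_ext _ _⟩⟩
  have : IsIso (homMap U φ) := NatIso.isIso_of_isIso_app _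
  rw [← pullbackHom_snd (hU.to X) φ]
  infer_instance

end HomComplex

section ReedyFibrant

variable {D : Type u} [Category.{v} D] [HasFiniteLimits D] {Fib : MorphismProperty D}
  {X Y : SimplicialObject D}

lemma lift_matchingCone_iff [Fib.RespectsIso] {n : ℕ} {c : Cone (matchingDiagram X n)}
    (hc : IsLimit c) : Fib (hc.lift (matchingCone X n)) ↔ Fib (matchingMap X n) := by
  let e : c.pt ≅ limit (matchingDiagram X n) := hc.conePointUniqueUpToIso (limit.isLimit _)
  have lift_e : hc.lift (matchingCone X n) ≫ e.hom = limit.lift _ (matchingCone X n) :=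
    hc.lift_comp_conePointUniqueUpToIso_hom (limit.isLimit _)
  change _ ↔ Fib (limit.lift _ (matchingCone X n))
  rw [← lift_e, Fib.cancel_right_of_respectsIso]

lemma isIso_matchingMap_of_isTerminal (hX : IsTerminal X) (n : ℕ) : IsIso (matchingMap X n) :=
  isIso_of_isTerminal (hX.isTerminalObj ((evaluation _ D).obj (op (.mk n))))
    (hX.isTerminalObj (matchingFunctor D n)) _

lemma reedyFibration_iff_of_isTerminal [Fib.RespectsIso] (φ : X ⟶ Y) (hY : IsTerminal Y) :
    ReedyFibration Fib φ ↔ ∀ n, Fib (matchingMap X n) :=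
  forall_congr' fun n => by
    have := isIso_matchingMap_of_isTerminal hY n
    rw [← relMatchingMap_fst φ n, Fib.cancel_right_of_respectsIso]

lemma ModelClasses.reedyFibrant_iff (S : ModelClasses D) [S.Fib.RespectsIso] :
    S.ReedyFibrant X ↔ ReedyFibration S.Fib (terminal.from X) := by
  rw [reedyFibration_iff_of_isTerminal _ terminalIsTerminal]
  refine forall_congr' fun n => ⟨?_, fun h => ⟨_, limit.isLimit _, h⟩⟩
  rintro ⟨c, hc, h⟩
  exact (lift_matchingCone_iff hc).1 h

lemma ReedyFibration.terminal_from [Fib.IsStableUnderComposition] [Fib.IsStableUnderBaseChange]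
    {φ : X ⟶ Y} (hφ : ReedyFibration Fib φ) (hY : ReedyFibration Fib (terminal.from Y)) :
    ReedyFibration Fib (terminal.from X) := by
  rw [← terminal.comp_from φ]
  exact (ReedyFibration Fib).comp_mem _ _ hφ hY

variable [Fib.IsStableUnderBaseChange]

lemma reedyFibration_prod_fst (hY : ReedyFibration Fib (terminal.from Y)) :
    ReedyFibration Fib (prod.fst : X ⨯ Y ⟶ X) :=
  (ReedyFibration Fib).of_isPullback (IsPullback.of_hasBinaryProduct' X Y).flip hY

lemma reedyFibration_prod_snd (hX : ReedyFibration Fib (terminal.from X)) :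
    ReedyFibration Fib (prod.snd : X ⨯ Y ⟶ Y) :=
  (ReedyFibration Fib).of_isPullback (IsPullback.of_hasBinaryProduct' X Y) hX

end ReedyFibrant

section KenBrown

lemma isSSetWeakEquivalence_homMap_iff_of_commSq {D : Type u} [Category.{v} D] (X : D)
    {A B A' B' : SimplicialObject D} {p : A ⟶ B} {p' : A' ⟶ B'} {f : A ⟶ A'} {g : B ⟶ B'}
    (sq : CommSq f p p' g)
    (hp : IsSSetWeakEquivalence (homMap X p)) (hp' : IsSSetWeakEquivalence (homMap X p')) :
    IsSSetWeakEquivalence (homMap X f) ↔ IsSSetWeakEquivalence (homMap X g) := by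
  have h := sSetWeakEquivalences.precomp_iff (W' := sSetWeakEquivalences)
    (homMap X p) (homMap X g) hp
  rw [← homMap_comp, ← sq.w, homMap_comp,
    sSetWeakEquivalences.postcomp_iff (W' := sSetWeakEquivalences) _ _ hp'] at h
  exact h

variable (N : Type u) [Category.{v} N] [ModelCategory N]

/-- The maps of simplicial objects which are weak equivalences in each simplicial degree. -/
abbrev levelwiseWeakEquivalences : MorphismProperty (SimplicialObject N) :=
  (weakEquivalences N).functorCategory SimplexCategoryᵒᵖ

instance : (levelwiseWeakEquivalences N).HasTwoOutOfThreeProperty where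
  comp_mem _ _ hf hg k := (weakEquivalences N).comp_mem _ _ (hf k) (hg k)
  of_postcomp _ _ hg hfg k := (weakEquivalences N).of_postcomp _ _ (hg k) (hfg k)
  of_precomp _ _ hf hfg k := (weakEquivalences N).of_precomp _ _ (hf k) (hfg k)

variable {N} {A B : SimplicialObject N} {φ : A ⟶ B}

lemma ReedyFibration.trivialFibrations (hφ : ReedyFibration (fibrations N) φ)
    (hW : levelwiseWeakEquivalences N φ) :
    ReedyFibration (trivialFibrations N) φ := fun n => by
  induction n using Nat.strong_induction_on with
  | _ n ih =>
    have trivFib_matchingObjMap : HomotopicalAlgebra.trivialFibrations N (matchingObjMap φ n) := by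
      rw [← cofibrations_rlp]
      intro U V i hi
      refine hasLiftingProperty_matchingObjMap i φ fun m hm => ?_
      have trivFib_m := ih m hm
      rw [← cofibrations_rlp] at trivFib_m
      exact trivFib_m i hi
    have trivFib_snd : HomotopicalAlgebra.trivialFibrations N
        (pullback.snd (matchingObjMap φ n) (matchingMap B n)) :=
      MorphismProperty.pullback_snd _ _ trivFib_matchingObjMap
    refine ⟨hφ n, (weakEquivalences N).of_postcomp _ _ trivFib_snd.2 ?_⟩
    rw [relMatchingMap_snd]
    exact hW _

variable (X : N) [IsCofibrant X]

lemma ReedyFibration.isSSetWeakEquivalence_homMap (hφ : ReedyFibration (fibrations N) φ)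
    (hW : levelwiseWeakEquivalences N φ) : IsSSetWeakEquivalence (homMap X φ) := by
  have rlp_boundary (n : ℕ) : HasLiftingProperty (SSet.boundary n).ι (homMap X φ) := by
    have trivFib := hφ.trivialFibrations hW n
    rw [← cofibrations_rlp] at trivFib
    have := trivFib (initialIsInitial.to X) (mem_cofibrations (initial.to X))
    exact hasLiftingProperty_homMap φ initialIsInitial
  refine isSSetWeakEquivalence_of_rlp_monomorphisms ?_
  rw [SSet.rlp_monomorphisms]
  rintro _ _ _ ⟨n⟩
  exact rlp_boundary n

lemma ReedyFibration.isSSetWeakEquivalence_homMap_iff_of_commSq {A' B' Y Y' : SimplicialObject N}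
    {φ' : A' ⟶ B'} {f : A ⟶ A'} {g : B ⟶ B'} (sq : CommSq f φ φ' g) {j : Y ⟶ A} {j' : Y' ⟶ A'}
    (hφ : ReedyFibration (fibrations N) φ) (hj : levelwiseWeakEquivalences N j)
    (hjφ : levelwiseWeakEquivalences N (j ≫ φ))
    (hφ' : ReedyFibration (fibrations N) φ') (hj' : levelwiseWeakEquivalences N j')
    (hjφ' : levelwiseWeakEquivalences N (j' ≫ φ')) :
    IsSSetWeakEquivalence (homMap X f) ↔ IsSSetWeakEquivalence (homMap X g) :=
  RightLoc.isSSetWeakEquivalence_homMap_iff_of_commSq X sq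
    (hφ.isSSetWeakEquivalence_homMap X (MorphismProperty.of_precomp _ _ _ hj hjφ))
    (hφ'.isSSetWeakEquivalence_homMap X (MorphismProperty.of_precomp _ _ _ hj' hjφ'))

end KenBrown

section Independence

variable {N : Type u} [Category.{v} N] [ModelCategory N]

lemma exists_levelwiseWeakEquivalence_reedyFibration {Y B : SimplicialObject N} (ψ : Y ⟶ B) :
    ∃ (E : SimplicialObject N) (ι : Y ⟶ E) (π : E ⟶ B), ι ≫ π = ψ ∧
      levelwiseWeakEquivalences N ι ∧ ReedyFibration (fibrations N) π := by
  obtain ⟨E, ι, π, fac, hι, hπ⟩ := exists_reedy_factorization (fibrations N) ⊤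
    (fun f _ => by
      let h := MorphismProperty.factorizationData (trivialCofibrations N) (fibrations N) f
      exact ⟨h.Z, h.i, h.p, by rw [fibrations_llp]; exact h.hi, h.hp, h.fac⟩)
    (fun _ _ _ => trivial) ψ (fun _ => trivial)
  rw [fibrations_llp] at hι
  exact ⟨E, ι, π, fac, fun k => (hι k).2, hπ⟩

variable (X : N) [IsCofibrant X]

lemma isSSetWeakEquivalence_homMap_iff_of_span {Y Y' P P' Q Q' : SimplicialObject N}
    {a : Y ⟶ P} {b : Y ⟶ Q} {a' : Y' ⟶ P'} {b' : Y' ⟶ Q'} {ψ : Y ⟶ Y'} {ρ : P ⟶ P'} {σ : Q ⟶ Q'}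
    (sqP : CommSq ψ a a' ρ) (sqQ : CommSq ψ b b' σ)
    (ha : levelwiseWeakEquivalences N a) (hb : levelwiseWeakEquivalences N b)
    (ha' : levelwiseWeakEquivalences N a') (hb' : levelwiseWeakEquivalences N b')
    (hP : ReedyFibration (fibrations N) (terminal.from P))
    (hQ : ReedyFibration (fibrations N) (terminal.from Q))
    (hP' : ReedyFibration (fibrations N) (terminal.from P'))
    (hQ' : ReedyFibration (fibrations N) (terminal.from Q')) :
    IsSSetWeakEquivalence (homMap X ρ) ↔ IsSSetWeakEquivalence (homMap X σ) := by
  obtain ⟨E', ι', q', fac', hι', hq'⟩ :=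
    exists_levelwiseWeakEquivalence_reedyFibration (prod.lift a' b')
  obtain ⟨E, ι, π, fac, hι, hπ⟩ := exists_levelwiseWeakEquivalence_reedyFibration
    (pullback.lift (f := prod.map ρ σ) (g := q') (prod.lift a b) (ψ ≫ ι') (by
      rw [Category.assoc, fac']
      ext1 <;> simp [sqP.w, sqQ.w]))
  let q : E ⟶ P ⨯ Q := π ≫ pullback.fst _ _
  let e : E ⟶ E' := π ≫ pullback.snd _ _
  have q_map : q ≫ prod.map ρ σ = e ≫ q' := by simp only [q, e, Category.assoc, pullback.condition]
  have ι_q : ι ≫ q = prod.lift a b := by simp only [q, reassoc_of% fac, pullback.lift_fst]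
  have hq : ReedyFibration (fibrations N) q :=
    MorphismProperty.comp_mem _ _ _ hπ (MorphismProperty.pullback_fst _ _ hq')
  have fst := ReedyFibration.isSSetWeakEquivalence_homMap_iff_of_commSq X (f := e) (g := ρ)
    (φ := q ≫ prod.fst) (φ' := q' ≫ prod.fst) ⟨by simp [← reassoc_of% q_map]⟩
    (MorphismProperty.comp_mem _ _ _ hq (reedyFibration_prod_fst hQ)) hι
    (by rwa [reassoc_of% ι_q, prod.lift_fst])
    (MorphismProperty.comp_mem _ _ _ hq' (reedyFibration_prod_fst hQ')) hι'
    (by rwa [reassoc_of% fac', prod.lift_fst])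
  have snd := ReedyFibration.isSSetWeakEquivalence_homMap_iff_of_commSq X (f := e) (g := σ)
    (φ := q ≫ prod.snd) (φ' := q' ≫ prod.snd) ⟨by simp [← reassoc_of% q_map]⟩
    (MorphismProperty.comp_mem _ _ _ hq (reedyFibration_prod_snd hP)) hι
    (by rwa [reassoc_of% ι_q, prod.lift_snd])
    (MorphismProperty.comp_mem _ _ _ hq' (reedyFibration_prod_snd hP')) hι'
    (by rwa [reassoc_of% fac', prod.lift_snd])
  exact fst.symm.trans snd

end Independence

namespace ModelClasses

section Resolutions

variable {D : Type u} [Category.{v} D]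

instance [ModelCategory D] : (ofModelCategory D).Fib.IsMultiplicative :=
  inferInstanceAs (fibrations D).IsMultiplicative

instance [ModelCategory D] : (ofModelCategory D).Fib.IsStableUnderBaseChange :=
  inferInstanceAs (fibrations D).IsStableUnderBaseChange

variable (S : ModelClasses D)

lemma nonempty_mapResolution_of_factorization [HasFiniteLimits D] [HasFiniteColimits D]
    [S.Fib.IsMultiplicative] [S.Fib.IsStableUnderBaseChange] (good : ObjectProperty D)
    (hfac : ∀ {X Y : D} (f : X ⟶ Y), good X →
      ∃ (Z : D) (i : X ⟶ Z) (p : Z ⟶ Y), S.Fib.llp i ∧ S.Fib p ∧ i ≫ p = f)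
    (hgood : ∀ {X Y : D} (i : X ⟶ Y), good X → S.Fib.llp i → good Y)
    (hW : ∀ {X Y : D} (i : X ⟶ Y), good X → S.Fib.llp i → S.W i)
    {A B A' B' : D} {f : A ⟶ B} {a : A' ⟶ A} {b : B' ⟶ B} {f' : A' ⟶ B'} (sq : CommSq a f' f b)
    (ha : S.W a) (hb : S.W b) (hA' : good A') (hB' : good B') :
    Nonempty (S.MapResolution f) := by
  obtain ⟨resB, jB, πB, -, hjB, hπB⟩ := exists_reedy_factorization S.Fib good hfac hgood
    (terminal.from ((SimplicialObject.const D).obj B')) fun _ => hB'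
  obtain ⟨resA, jA, φ, fac, hjA, hφ⟩ := exists_reedy_factorization S.Fib good hfac hgood
    ((SimplicialObject.const D).map f' ≫ jB) fun _ => hA'
  obtain rfl : πB = terminal.from resB := Subsingleton.elim _ _
  exact ⟨{
    A', B', a, b, f', resA, resB, jA, jB, φ
    weq_a := ha
    weq_b := hb
    comm := sq.w
    isRes_A := ⟨S.reedyFibrant_iff.2 (hφ.terminal_from hπB), fun k => hW _ hA' (hjA k)⟩
    isRes_B := ⟨S.reedyFibrant_iff.2 hπB, fun k => hW _ hB' (hjB k)⟩
    comm_res := fac }⟩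

variable {S}

lemma IsModel.cof_eq_llp (hS : S.IsModel) : S.Cof = S.TrivFib.llp := by
  obtain ⟨_, rfl⟩ := hS
  exact (trivialFibrations_llp D).symm

lemma IsModel.nonempty_mapResolution (hS : S.IsModel) {A B : D} (f : A ⟶ B) :
    Nonempty (S.MapResolution f) := by
  obtain ⟨_, rfl⟩ := hS
  have llp_fib : (ofModelCategory D).Fib.llp = trivialCofibrations D := fibrations_llp D
  refine nonempty_mapResolution_of_factorization _ ⊤ (fun f _ => ?_) (fun _ _ _ => trivial)
    (fun i _ hi => ?_) (a := 𝟙 A) (b := 𝟙 B) (f' := f) ⟨by simp⟩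
    ((weakEquivalences D).id_mem _) ((weakEquivalences D).id_mem _) trivial trivial
  · let h := MorphismProperty.factorizationData (trivialCofibrations D) (fibrations D) f
    exact ⟨h.Z, h.i, h.p, by rw [llp_fib]; exact h.hi, h.hp, h.fac⟩
  · rw [llp_fib] at hi
    exact hi.2

namespace SemiModelAxioms

variable {dom : ObjectProperty D} (hS : S.SemiModelAxioms dom)

include hS

lemma exists_cof_trivFib {X Y : D} (f : X ⟶ Y) :
    ∃ (Z : D) (i : X ⟶ Z) (p : Z ⟶ Y), S.Cof i ∧ S.TrivFib p ∧ i ≫ p = f := by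
  have := hS.factor_cof_trivFib
  let h := MorphismProperty.factorizationData S.Cof S.TrivFib f
  exact ⟨h.Z, h.i, h.p, h.hi, h.hp, h.fac⟩

lemma exists_trivCof_fib {X Y : D} (f : X ⟶ Y) (hX : dom X) :
    ∃ (Z : D) (i : X ⟶ Z) (p : Z ⟶ Y), S.TrivCof i ∧ S.Fib p ∧ i ≫ p = f := by
  obtain ⟨h⟩ := hS.factor_trivCof_fib
  exact ⟨_, h.i.app ⟨Arrow.mk f, hX⟩, h.p.app ⟨Arrow.mk f, hX⟩, h.hi _, h.hp _, h.fac _⟩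

lemma cof_eq_llp : S.Cof = S.TrivFib.llp := by
  have := hS.retract_Cof
  refine le_antisymm (fun _ _ i hi _ _ p hp => hS.lift_cof_trivFib i p hi hp) fun X Y f hf => ?_
  obtain ⟨Z, i, p, hi, hp, fac⟩ := hS.exists_cof_trivFib f
  have := hf p hp
  exact S.Cof.of_retract (RetractArrow.ofLeftLiftingProperty fac) hi

lemma weq_of_llp {X Y : D} (f : X ⟶ Y) (hX : dom X) (hf : S.Fib.llp f) : S.W f := by
  have := hS.retract_W
  obtain ⟨Z, i, p, hi, hp, fac⟩ := hS.exists_trivCof_fib f hX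
  have := hf p hp
  exact S.W.of_retract (RetractArrow.ofLeftLiftingProperty fac) hi.2

lemma cofibrant_of_llp {X Y : D} (i : X ⟶ Y) (hX : S.Cofibrant X) (hi : S.TrivFib.llp i) :
    S.Cofibrant Y := by
  obtain ⟨I, hI, hX⟩ := hX
  refine ⟨I, hI, ?_⟩
  rw [hS.cof_eq_llp] at hX ⊢
  rw [← hI.hom_ext (hI.to X ≫ i) (hI.to Y)]
  exact MorphismProperty.comp_mem _ _ _ hX hi

lemma exists_cofibrant_approximation (A : D) :
    ∃ (A' : D) (a : A' ⟶ A), S.Cofibrant A' ∧ S.TrivFib a := by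
  have := hS.hasColimits
  obtain ⟨A', i, a, hi, ha, -⟩ := hS.exists_cof_trivFib (initial.to A)
  obtain rfl : i = initialIsInitial.to A' := initialIsInitial.hom_ext _ _
  exact ⟨A', a, ⟨_, initialIsInitial, hi⟩, ha⟩

end SemiModelAxioms

lemma IsSemiModel.nonempty_mapResolution (hS : S.IsSemiModel) [S.Fib.IsMultiplicative] {A B : D}
    (f : A ⟶ B) : Nonempty (S.MapResolution f) := by
  have := hS.hasLimits
  have := hS.hasColimits
  have := hS.pullback_fib
  obtain ⟨A', a, hA', ha⟩ := hS.exists_cofibrant_approximation A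
  obtain ⟨B', b, hB', hb⟩ := hS.exists_cofibrant_approximation B
  obtain ⟨I, hI, hIA'⟩ := id hA'
  have := hS.lift_cof_trivFib _ b hIA' hb
  have sq : CommSq (hI.to B') (hI.to A') b (a ≫ f) := ⟨hI.hom_ext _ _⟩
  refine nonempty_mapResolution_of_factorization S S.Cofibrant (fun f hX => ?_)
    (fun i hX hi => hS.cofibrant_of_llp i hX fun _ _ q hq => hi q hq.1)
    (fun i hX hi => hS.weq_of_llp i hX hi) ⟨sq.fac_right.symm⟩ ha.2 hb.2 hA' hB'
  obtain ⟨Z, i, p, hi, hp, fac⟩ := hS.exists_trivCof_fib f hX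
  exact ⟨Z, i, p, fun _ _ q hq => hS.lift_trivCof_fib i q hX hi hq, hp, fac⟩

end Resolutions

section Independence

variable {N : Type u} [Category.{v} N] [ModelCategory N] {A B : N} {f : A ⟶ B}

theorem MapResolution.isSSetWeakEquivalence_homMap_iff (r r' : (ofModelCategory N).MapResolution f)
    (X : N) [IsCofibrant X] :
    IsSSetWeakEquivalence (homMap X r.φ) ↔ IsSSetWeakEquivalence (homMap X r'.φ) := by
  obtain ⟨Q', iB, πB, -, hiB, hQ'⟩ := exists_levelwiseWeakEquivalence_reedyFibration
    (terminal.from ((SimplicialObject.const N).obj B))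
  obtain ⟨Q, iA, χ, fac, hiA, hχ⟩ := exists_levelwiseWeakEquivalence_reedyFibration
    ((SimplicialObject.const N).map f ≫ iB)
  obtain rfl : πB = terminal.from Q' := Subsingleton.elim _ _
  have iff_χ (r : (ofModelCategory N).MapResolution f) :
      IsSSetWeakEquivalence (homMap X r.φ) ↔ IsSSetWeakEquivalence (homMap X χ) :=
    isSSetWeakEquivalence_homMap_iff_of_span X ⟨r.comm_res.symm⟩
      (b := (SimplicialObject.const N).map r.a ≫ iA) (b' := (SimplicialObject.const N).map r.b ≫ iB)
      ⟨by rw [Category.assoc, fac, ← Functor.map_comp_assoc, ← Functor.map_comp_assoc, r.comm]⟩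
      r.isRes_A.weq (MorphismProperty.comp_mem _ _ _ (fun _ => r.weq_a) hiA)
      r.isRes_B.weq (MorphismProperty.comp_mem _ _ _ (fun _ => r.weq_b) hiB)
      ((reedyFibrant_iff _).1 r.isRes_A.reedyFibrant) (hχ.terminal_from hQ')
      ((reedyFibrant_iff _).1 r.isRes_B.reedyFibrant) hQ'
  exact (iff_χ r).trans (iff_χ r').symm

end Independence

end ModelClasses

section Adjunction

variable {C : Type u} {D : Type u'} [Category.{v} C] [Category.{v} D] {F : C ⥤ D} {U : D ⥤ C}

/-- The adjunction isomorphism of simplicial hom-sets `D(F X, A_•) ≅ C(X, U A_•)`. -/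
def homSSetAdjunctionIso (adj : F ⊣ U) (X : C) (A : SimplicialObject D) :
    homSSet (F.obj X) A ≅ homSSet X (((SimplicialObject.whiskering D C).obj U).obj A) :=
  NatIso.ofComponents (fun k => (adj.homEquiv X (A.obj k)).toIso) fun α => by
    ext g
    exact adj.homEquiv_naturality_right g (A.map α)

lemma isSSetWeakEquivalence_homMap_leftAdjoint_iff (adj : F ⊣ U) (X : C) {A B : SimplicialObject D}
    (φ : A ⟶ B) : IsSSetWeakEquivalence (homMap (F.obj X) φ) ↔
      IsSSetWeakEquivalence (homMap X (((SimplicialObject.whiskering D C).obj U).map φ)) :=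
  sSetWeakEquivalences.arrow_mk_iso_iff
    (Arrow.isoMk (homSSetAdjunctionIso adj X A) (homSSetAdjunctionIso adj X B) (by
      ext k g
      exact (adj.homEquiv_naturality_right g (φ.app k)).symm))

namespace ModelClasses

variable {S : ModelClasses D} {N : ModelClasses C}

lemma ReedyFibrant.map [PreservesFiniteLimits U] (hFib : S.Fib ≤ N.Fib.inverseImage U)
    {X : SimplicialObject D} (hX : S.ReedyFibrant X) :
    N.ReedyFibrant (((SimplicialObject.whiskering D C).obj U).obj X) := fun n => by
  obtain ⟨c, hc, hfib⟩ := hX n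
  let UX := ((SimplicialObject.whiskering D C).obj U).obj X
  let c' : Cone (matchingDiagram UX n) := U.mapCone c
  let hc' : IsLimit c' := isLimitOfPreserves U hc
  have map_lift : U.map (hc.lift (matchingCone X n)) = hc'.lift (matchingCone UX n) :=
    hc'.uniq (matchingCone UX n) _ fun j =>
      (U.map_comp _ _).symm.trans (congrArg U.map (hc.fac (matchingCone X n) j))
  refine ⟨c', hc', ?_⟩
  rw [← map_lift]
  exact hFib _ hfib

variable (U) in
/-- The coaugmentation of `U X_•` obtained by applying `U` to a coaugmentation of `X_•`. -/
def mapCoaugmentation {A : D} {X : SimplicialObject D}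
    (j : (SimplicialObject.const D).obj A ⟶ X) :
    (SimplicialObject.const C).obj (U.obj A) ⟶ ((SimplicialObject.whiskering D C).obj U).obj X where
  app n := U.map (j.app n)
  naturality _ _ α := by
    have nat_j := congrArg U.map ((Category.id_comp _).symm.trans (j.naturality α))
    exact (Category.id_comp _).trans (nat_j.trans (U.map_comp _ _))

section Map

variable [PreservesFiniteLimits U] (hW : S.W ≤ N.W.inverseImage U)
  (hFib : S.Fib ≤ N.Fib.inverseImage U)

include hW hFib

lemma IsSimplicialResolution.map {A : D} {X : SimplicialObject D}
    {j : (SimplicialObject.const D).obj A ⟶ X} (hj : S.IsSimplicialResolution j) :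
    N.IsSimplicialResolution (mapCoaugmentation U j) where
  reedyFibrant := hj.reedyFibrant.map hFib
  weq n := hW _ (hj.weq n)

/-- The image of a resolution of `f` under a functor `U` preserving finite limits, weak
equivalences and fibrations is a resolution of `U f`. -/
def MapResolution.map {A B : D} {f : A ⟶ B} (r : S.MapResolution f) :
    N.MapResolution (U.map f) where
  A' := U.obj r.A'
  B' := U.obj r.B'
  a := U.map r.a
  b := U.map r.b
  weq_a := hW _ r.weq_a
  weq_b := hW _ r.weq_b
  f' := U.map r.f'
  comm := by simp only [← U.map_comp, r.comm]
  resA := _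
  resB := _
  jA := _
  jB := _
  isRes_A := r.isRes_A.map hW hFib
  isRes_B := r.isRes_B.map hW hFib
  φ := ((SimplicialObject.whiskering D C).obj U).map r.φ
  comm_res := by
    ext n
    have := congrArg U.map (NatTrans.congr_app r.comm_res n)
    rwa [NatTrans.comp_app, NatTrans.comp_app, U.map_comp, U.map_comp] at this

end Map

end ModelClasses

end Adjunction

section Transfer

variable {M : Type u} [Category.{v} M] {T : Monad M} {N : ModelClasses M}
  {S S' : ModelClasses T.Algebra}

namespace IsTransferred

lemma weq_eq (hS : IsTransferred N S) : S.W = N.W.inverseImage T.forget := by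
  ext A B f
  exact hS.weq_iff f

lemma fib_eq (hS : IsTransferred N S) : S.Fib = N.Fib.inverseImage T.forget := by
  ext A B f
  exact hS.fib_iff f

lemma isMultiplicative_fib (hS : IsTransferred N S) [N.Fib.IsMultiplicative] :
    S.Fib.IsMultiplicative := by
  rw [hS.fib_eq]
  infer_instance

lemma eq (hS : IsTransferred N S) (hS' : IsTransferred N S') (hCof : S.Cof = S.TrivFib.llp)
    (hCof' : S'.Cof = S'.TrivFib.llp) : S = S' := by
  have hW : S.W = S'.W := hS.weq_eq.trans hS'.weq_eq.symm
  have hFib : S.Fib = S'.Fib := hS.fib_eq.trans hS'.fib_eq.symm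
  exact ModelClasses.ext hW hFib
    (by rw [hCof, hCof', ModelClasses.TrivFib, ModelClasses.TrivFib, hW, hFib])

lemma exists_and_iff (hS : IsTransferred N S) (hCof : S.Cof = S.TrivFib.llp)
    {P : ModelClasses T.Algebra → Prop} (hP : ∀ S', P S' → S'.Cof = S'.TrivFib.llp) :
    ((∃ S', IsTransferred N S' ∧ P S') ↔ P S) ∧ ∀ S', IsTransferred N S' ∧ P S' → S' = S := by
  have unique (S') (h : IsTransferred N S' ∧ P S') : S' = S := h.1.eq hS (hP S' h.2) hCof
  exact ⟨⟨fun ⟨S', h⟩ => unique S' h ▸ h.2, fun h => ⟨S, hS, h⟩⟩, unique⟩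

end IsTransferred

end Transfer

section Localization

variable {M : Type u} [Category.{v} M] [ModelCategory M] {K : Set M} {T : Monad M}
  {S : ModelClasses T.Algebra}

lemma IsTransferred.colocalEquivalence_iff
    (hS : IsTransferred (ModelClasses.ofModelCategory M) S) (hK : ∀ X ∈ K, IsCofibrant X)
    {A B : T.Algebra} {f : A ⟶ B} (hf : Nonempty (S.MapResolution f)) :
    S.ColocalEquivalence (T.free.obj '' K) f ↔
      (ModelClasses.ofModelCategory M).ColocalEquivalence K (T.forget.map f) := by
  let forgetRes (r : S.MapResolution f) :
      (ModelClasses.ofModelCategory M).MapResolution (T.forget.map f) :=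
    r.map hS.weq_eq.le hS.fib_eq.le
  have homMap_free_iff (r : S.MapResolution f) (X : M) :
      IsSSetWeakEquivalence (homMap (T.free.obj X) r.φ) ↔
        IsSSetWeakEquivalence (homMap X (forgetRes r).φ) :=
    isSSetWeakEquivalence_homMap_leftAdjoint_iff T.adj X r.φ
  refine ⟨fun h X hX => ?_, ?_⟩
  · obtain ⟨r, hr⟩ := h _ ⟨X, hX, rfl⟩
    exact ⟨forgetRes r, (homMap_free_iff r X).1 hr⟩
  · rintro h _ ⟨X, hX, rfl⟩
    obtain ⟨r⟩ := hf
    obtain ⟨r', hr'⟩ := h X hX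
    have := hK X hX
    exact ⟨r, (homMap_free_iff r X).2 ((r'.isSSetWeakEquivalence_homMap_iff (forgetRes r) X).1 hr')⟩

lemma IsTransferred.rightBousfield (hS : IsTransferred (ModelClasses.ofModelCategory M) S)
    (hK : ∀ X ∈ K, IsCofibrant X)
    (hres : ∀ {A B : T.Algebra} (f : A ⟶ B), Nonempty (S.MapResolution f)) :
    IsTransferred ((ModelClasses.ofModelCategory M).rightBousfield K)
      (S.rightBousfield (T.free.obj '' K)) where
  weq_iff f := hS.colocalEquivalence_iff hK (hres f)
  fib_iff := hS.fib_iff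

end Localization

end RightLoc

open RightLoc in
theorem mainTheorem2_general {M : Type u} [Category.{v} M] [ModelCategory M]
    (K : Set M) (hK : ∀ X ∈ K, IsCofibrant X)
    (T : Monad M) (S : ModelClasses T.Algebra) :
    (IsAdmissibleStructure (ModelClasses.ofModelCategory M) S →
      ((∃ S' : ModelClasses T.Algebra,
          IsAdmissibleStructure ((ModelClasses.ofModelCategory M).rightBousfield K) S') ↔
        (S.rightBousfield (T.free.obj '' K)).IsModel) ∧
      ∀ S' : ModelClasses T.Algebra,
        IsAdmissibleStructure ((ModelClasses.ofModelCategory M).rightBousfield K) S' →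
          S' = S.rightBousfield (T.free.obj '' K)) ∧
    (IsSemiAdmissibleStructure (ModelClasses.ofModelCategory M) S →
      (((∃ S' : ModelClasses T.Algebra,
          IsSemiAdmissibleStructure ((ModelClasses.ofModelCategory M).rightBousfield K) S') ↔
        (S.rightBousfield (T.free.obj '' K)).IsSemiModel) ∧
      ∀ S' : ModelClasses T.Algebra,
        IsSemiAdmissibleStructure ((ModelClasses.ofModelCategory M).rightBousfield K) S' →
          S' = S.rightBousfield (T.free.obj '' K)) ∧
      ((∃ S' : ModelClasses T.Algebra,
          IsSemiAdmissibleOverStructure ((ModelClasses.ofModelCategory M).rightBousfield K) S') ↔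
        (S.rightBousfield (T.free.obj '' K)).IsSemiModelOver
          ((ModelClasses.ofModelCategory M).rightBousfield K) T.forget) ∧
      ∀ S' : ModelClasses T.Algebra,
        IsSemiAdmissibleOverStructure ((ModelClasses.ofModelCategory M).rightBousfield K) S' →
          S' = S.rightBousfield (T.free.obj '' K)) := by
  refine ⟨fun hS => ?_, fun hS => ?_⟩
  · have hR := hS.1.rightBousfield hK hS.2.nonempty_mapResolution
    exact hR.exists_and_iff rfl fun _ h => h.cof_eq_llp
  · have := hS.1.isMultiplicative_fib
    have hR := hS.1.rightBousfield hK hS.2.nonempty_mapResolution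
    exact ⟨hR.exists_and_iff rfl fun _ h => h.cof_eq_llp,
      hR.exists_and_iff rfl fun _ h => h.toSemiModelAxioms.cof_eq_llp⟩

open RightLoc in
theorem mainTheorem2 {M : Type u} [Category.{v} M] [ModelCategory M]
    (K : Set M) (hK : ∀ X ∈ K, IsCofibrant X)
    (hRK : ((ModelClasses.ofModelCategory M).rightBousfield K).IsModel)
    (T : Monad M) (S : ModelClasses T.Algebra) :
    -- model categories
    (IsAdmissibleStructure (ModelClasses.ofModelCategory M) S →
      ((∃ S' : ModelClasses T.Algebra,
          IsAdmissibleStructure ((ModelClasses.ofModelCategory M).rightBousfield K) S') ↔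
        (S.rightBousfield (T.free.obj '' K)).IsModel) ∧
      ∀ S' : ModelClasses T.Algebra,
        IsAdmissibleStructure ((ModelClasses.ofModelCategory M).rightBousfield K) S' →
          S' = S.rightBousfield (T.free.obj '' K)) ∧
    -- semi-model categories
    (IsSemiAdmissibleStructure (ModelClasses.ofModelCategory M) S →
      (((∃ S' : ModelClasses T.Algebra,
          IsSemiAdmissibleStructure ((ModelClasses.ofModelCategory M).rightBousfield K) S') ↔
        (S.rightBousfield (T.free.obj '' K)).IsSemiModel) ∧
      ∀ S' : ModelClasses T.Algebra,
        IsSemiAdmissibleStructure ((ModelClasses.ofModelCategory M).rightBousfield K) S' →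
          S' = S.rightBousfield (T.free.obj '' K)) ∧
      -- the same with cofibrancy of domains tested in the base
      ((∃ S' : ModelClasses T.Algebra,
          IsSemiAdmissibleOverStructure ((ModelClasses.ofModelCategory M).rightBousfield K) S') ↔
        (S.rightBousfield (T.free.obj '' K)).IsSemiModelOver
          ((ModelClasses.ofModelCategory M).rightBousfield K) T.forget) ∧
      ∀ S' : ModelClasses T.Algebra,
        IsSemiAdmissibleOverStructure ((ModelClasses.ofModelCategory M).rightBousfield K) S' →
          S' = S.rightBousfield (T.free.obj '' K)) :=
  mainTheorem2_general K hK T S
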